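/- Let $B$ be a finite band (a semigroup in which every element is idempotent). Let $\Lambda(B)$ be the set of principal ideals $BbB$ ($b\in B$), ordered by inclusion, and let $\sigma(b)=BbB$. Write $a\le_{\mathscr R}b$ if $ba=a$, and $a\le_{\mathscr L}b$ if $ab=a$. Assume that $B$ is connected: for every $X\in\Lambda(B)$, the graph on $\sigma^{-1}(X)$ in which distinct elements are adjacent when they have a common upper bound in $B$ for $\le_{\mathscr R}$ is connected, and so is the graph defined in the same way with $\le_{\mathscr L}$. Fix an arbitrary choice of elements $f_X\in\sigma^{-1}(X)$, $X\in\Lambda(B)$, and put $L_X=\sigma^{-1}(X)\cap Bf_X$ and $R_X=\sigma^{-1}(X)\cap f_XB$. For $X<Y$, let $\Gamma_{\mathscr R}(Y,X)$ be the simple graph with vertex set $L_X$ in which $a$ is joined to $ba$ whenever $\sigma(b)\ge Y$ and $ba\ne a$, and in which distinct $a,c$ are joined whenever $a,c\le_{\mathscr R}b$ for some $b\in B$ with $\sigma(b)\not\ge Y$. For $X>Y$, let $\Gamma_{\mathscr L}(X,Y)$ be the simple graph with vertex set $R_Y$ in which $a$ is joined to $ab$ whenever $\sigma(b)\ge X$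 and $ab\ne a$, and in which distinct $a,c$ are joined whenever $a,c\le_{\mathscr L}b$ for some $b\in B$ with $\sigma(b)\not\ge X$. Let $Q(B)$ be the quiver with vertex set $\Lambda(B)$ in which the number of arrows from $X$ to $Y$ is $|\pi_0(\Gamma_{\mathscr R}(Y,X))|-1$ if $X<Y$, is $|\pi_0(\Gamma_{\mathscr L}(X,Y))|-1$ if $X>Y$, and is $0$ otherwise. For a commutative ring $k$ and a finite quiver $Q$, let $kQ$ be the path algebra (paths are composed from right to left) and $J_k$ its ideal with basis the paths of positive length. An ideal $I$ of $kQ$ is called admissible if $J_k^n\subseteq I\subseteq J_k^2$ for some $n\ge 2$ and $kQ/I$ is a projective $k$-module. Then there is an admissible ideal $I$ of $\mathbb ZQ(B)$ such that $\mathbb ZB\cong\mathbb ZQ(B)/I$ as rings and such that, for every commutative ring $k$, the canonical map $k\otimes_{\mathbb Z}I\to kQ(B)$ is injective, its image (again denoted $k\otimes I$) is an admissible ideal of $kQ(B)$, and $kB\cong kQ(B)/(k\otimes I)$ as $k$-algebras. Here $kB$ denotes the semigroup algebra of $B$ over $k$. -/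

import Mathlib

open scoped TensorProduct

universe u v w

noncomputable section

/-! ### Path algebras of quivers and admissible ideals -/

/-- A directed path in a quiver, together with its source and its target. -/
structure QPath (V : Type u) [Quiver.{v} V] : Type (max u v) where
  src : V
  tgt : V
  path : Quiver.Path src tgt

namespace QPath

variable {V : Type u} [Quiver.{v} V]

/-- The empty path at a vertex. -/
def nil (x : V) : QPath V := ⟨x, x, Quiver.Path.nil⟩

/-- The number of arrows of a path. -/
def length (p : QPath V) : ℕ := p.path.length

/-- The product `p q` of paths, composed from right to left: first `q`, then `p`. -/
def comp (p q : QPath V) (h : q.tgt = p.src) : QPath V :=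
  ⟨q.src, p.tgt, (q.path.cast rfl h).comp p.path⟩

theorem length_comp (p q : QPath V) (h : q.tgt = p.src) :
    (p.comp q h).length = q.length + p.length := by
  obtain ⟨a, b, p⟩ := p
  obtain ⟨c, d, q⟩ := q
  obtain rfl : d = a := h
  simp [comp, length]

theorem comp_assoc (p q r : QPath V) (h : q.tgt = p.src) (h' : r.tgt = q.src) :
    (p.comp q h).comp r h' = p.comp (q.comp r h') h := by
  obtain ⟨a, b, p⟩ := p
  obtain ⟨c, d, q⟩ := q
  obtain ⟨e, g, r⟩ := r
  obtain rfl : d = a := h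
  obtain rfl : g = c := h'
  simp [comp]

theorem nil_comp (p : QPath V) (x : V) (h : p.tgt = x) : (nil x).comp p h = p := by
  obtain ⟨a, b, p⟩ := p
  obtain rfl : b = x := h
  simp [comp, nil]

theorem comp_nil (p : QPath V) (x : V) (h : x = p.src) : p.comp (nil x) h = p := by
  obtain ⟨a, b, p⟩ := p
  obtain rfl : x = a := h
  simp [comp, nil]

end QPath

/-- The path algebra `k V` of a quiver `V`: the free `k`-module on the set of directed paths. -/
def PathAlgebra (k : Type w) [CommRing k] (V : Type u) [Quiver.{v} V] : Type (max u v w) :=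
  QPath V →₀ k

namespace PathAlgebra

variable (k : Type w) [CommRing k] (V : Type u) [Quiver.{v} V]

instance instAddCommGroup : AddCommGroup (PathAlgebra k V) := inferInstanceAs (AddCommGroup (QPath V →₀ k))

instance : Module k (PathAlgebra k V) := inferInstanceAs (Module k (QPath V →₀ k))

variable {k V}

/-- The basis element given by a path. -/
def ofPath (p : QPath V) : PathAlgebra k V := Finsupp.single p 1

/-- The coefficient of an element of the path algebra at a path. -/
def coeff (x : PathAlgebra k V) (p : QPath V) : k := (show QPath V →₀ k from x) p

variable (k) in
open Classical in
/-- The product of two paths in the path algebra: the concatenation `p q` (first `q`, then `p`)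
if `q` ends where `p` starts, and `0` otherwise. -/
def pathMul (p q : QPath V) : PathAlgebra k V :=
  if h : q.tgt = p.src then ofPath (p.comp q h) else 0

variable (k V) in
/-- The multiplication of the path algebra, as the bilinear extension of `pathMul`. -/
def mulHom : PathAlgebra k V →ₗ[k] PathAlgebra k V →ₗ[k] PathAlgebra k V :=
  Finsupp.linearCombination k fun p : QPath V =>
    (Finsupp.linearCombination k fun q : QPath V => pathMul k p q :
      PathAlgebra k V →ₗ[k] PathAlgebra k V)

instance : Mul (PathAlgebra k V) := ⟨fun x y => mulHom k V x y⟩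

/-- The identity is the sum of the empty paths. -/
instance [Fintype V] : One (PathAlgebra k V) := ⟨∑ x : V, ofPath (QPath.nil x)⟩

theorem mul_def (x y : PathAlgebra k V) : x * y = mulHom k V x y := rfl

theorem one_def [Fintype V] : (1 : PathAlgebra k V) = ∑ x : V, ofPath (QPath.nil x) := rfl

theorem mulHom_ofPath (p q : QPath V) :
    mulHom k V (ofPath p) (ofPath q) = pathMul k p q := by
  have h1 : mulHom k V (ofPath p) = Finsupp.linearCombination k fun q => pathMul k p q :=
    (Finsupp.linearCombination_single k 1 p).trans (one_smul k _)
  rw [h1]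
  exact (Finsupp.linearCombination_single k 1 q).trans (one_smul k _)

theorem ofPath_mul_ofPath (p q : QPath V) :
    (ofPath p * ofPath q : PathAlgebra k V) = pathMul k p q := mulHom_ofPath p q

theorem hom_ext {M : Type*} [AddCommGroup M] [Module k M] {f g : PathAlgebra k V →ₗ[k] M}
    (h : ∀ p, f (ofPath p) = g (ofPath p)) : f = g :=
  Finsupp.lhom_ext' fun p => LinearMap.ext_ring (h p)

theorem pathMul_of_eq {p q : QPath V} (h : q.tgt = p.src) :
    pathMul k p q = ofPath (p.comp q h) := dif_pos h

theorem pathMul_of_ne {p q : QPath V} (h : q.tgt ≠ p.src) : pathMul k p q = 0 := dif_neg h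

theorem ofPath_mul_assoc (p q r : QPath V) :
    (ofPath p * ofPath q * ofPath r : PathAlgebra k V) = ofPath p * (ofPath q * ofPath r) := by
  rw [ofPath_mul_ofPath, ofPath_mul_ofPath]
  by_cases h : q.tgt = p.src
  · rw [pathMul_of_eq h, ofPath_mul_ofPath]
    by_cases h' : r.tgt = q.src
    · have h1 : r.tgt = (p.comp q h).src := h'
      have h2 : (q.comp r h').tgt = p.src := h
      rw [pathMul_of_eq h', ofPath_mul_ofPath, pathMul_of_eq h1, pathMul_of_eq h2]
      exact congrArg ofPath (QPath.comp_assoc p q r h h')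
    · have h1 : r.tgt ≠ (p.comp q h).src := h'
      rw [pathMul_of_ne h', pathMul_of_ne h1, mul_def, map_zero]
  · rw [pathMul_of_ne h]
    by_cases h' : r.tgt = q.src
    · have h2 : (q.comp r h').tgt ≠ p.src := h
      rw [pathMul_of_eq h', ofPath_mul_ofPath, pathMul_of_ne h2, mul_def, map_zero,
        LinearMap.zero_apply]
    · rw [pathMul_of_ne h', mul_def, mul_def, map_zero, map_zero, LinearMap.zero_apply]

theorem mul_assoc' (x y z : PathAlgebra k V) : x * y * z = x * (y * z) := by
  have h1 (p q : QPath V) (z : PathAlgebra k V) :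
      ofPath p * ofPath q * z = ofPath p * (ofPath q * z) :=
    congrArg (fun g => g z) (hom_ext (f := mulHom k V (ofPath p * ofPath q))
      (g := mulHom k V (ofPath p) ∘ₗ mulHom k V (ofPath q)) (ofPath_mul_assoc p q))
  have h2 (p : QPath V) (y z : PathAlgebra k V) : ofPath p * y * z = ofPath p * (y * z) :=
    congrArg (fun g => g y) (hom_ext (f := (mulHom k V).flip z ∘ₗ mulHom k V (ofPath p))
      (g := mulHom k V (ofPath p) ∘ₗ (mulHom k V).flip z) fun q => h1 p q z)
  exact congrArg (fun g => g x) (hom_ext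
    (f := (mulHom k V).flip z ∘ₗ (mulHom k V).flip y)
    (g := (mulHom k V).flip (y * z)) fun p => h2 p y z)

theorem one_mul' [Fintype V] (x : PathAlgebra k V) : 1 * x = x := by
  have h : mulHom k V 1 = LinearMap.id := by
    refine hom_ext fun p => ?_
    rw [one_def, map_sum, LinearMap.sum_apply, Finset.sum_eq_single p.tgt]
    · rw [mulHom_ofPath, pathMul_of_eq (show p.tgt = (QPath.nil p.tgt).src from rfl)]
      exact congrArg ofPath (QPath.nil_comp p _ rfl)
    · intro b _ hb
      rw [mulHom_ofPath, pathMul_of_ne]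
      exact fun h => hb h.symm
    · exact fun h => absurd (Finset.mem_univ _) h
  exact congrArg (fun g => g x) h

theorem mul_one' [Fintype V] (x : PathAlgebra k V) : x * 1 = x := by
  have h : (mulHom k V).flip 1 = LinearMap.id := by
    refine hom_ext fun p => ?_
    rw [LinearMap.flip_apply, one_def, map_sum, Finset.sum_eq_single p.src]
    · rw [mulHom_ofPath, pathMul_of_eq (show (QPath.nil p.src).tgt = p.src from rfl)]
      exact congrArg ofPath (QPath.comp_nil p _ rfl)
    · intro b _ hb
      rw [mulHom_ofPath, pathMul_of_ne]
      exact hb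
    · exact fun h => absurd (Finset.mem_univ _) h
  exact congrArg (fun g => g x) h

instance [Fintype V] : Ring (PathAlgebra k V) where
  __ := instAddCommGroup k V
  mul_assoc := mul_assoc'
  one_mul := one_mul'
  mul_one := mul_one'
  left_distrib x y z := map_add (mulHom k V x) y z
  right_distrib x y z := by
    change mulHom k V (x + y) z = mulHom k V x z + mulHom k V y z
    rw [map_add, LinearMap.add_apply]
  zero_mul x := by
    change mulHom k V 0 x = 0
    rw [map_zero, LinearMap.zero_apply]
  mul_zero x := map_zero (mulHom k V x)

instance [Fintype V] : Algebra k (PathAlgebra k V) :=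
  Algebra.ofModule
    (fun c x y => by
      change mulHom k V (c • x) y = c • mulHom k V x y
      rw [map_smul, LinearMap.smul_apply])
    (fun c x y => map_smul (mulHom k V x) c y)

@[elab_as_elim]
theorem induction_on {P : PathAlgebra k V → Prop} (x : PathAlgebra k V) (h0 : P 0)
    (h1 : ∀ (c : k) (p : QPath V), P (c • ofPath p)) (h2 : ∀ x y, P x → P y → P (x + y)) : P x := by
  refine Finsupp.induction_linear x h0 h2 fun p c => ?_
  have : (Finsupp.single p c : QPath V →₀ k) = c • Finsupp.single p 1 := by simp
  rw [this]
  exact h1 c p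

theorem mem_supported_iff (s : Set (QPath V)) (x : PathAlgebra k V) :
    (∀ p, x.coeff p ≠ 0 → p ∈ s) ↔ x ∈ Submodule.span k (ofPath '' s) := by
  have h : x ∈ Submodule.span k (ofPath (k := k) '' s) ↔ (x.support : Set (QPath V)) ⊆ s := by
    refine Iff.trans ?_ (Finsupp.mem_supported k x)
    rw [Finsupp.supported_eq_span_single]
    rfl
  rw [h]
  exact ⟨fun hx p hp => hx p (Finsupp.mem_support_iff.1 hp),
    fun hx p hp => hx (Finsupp.mem_support_iff.2 hp)⟩

theorem mul_mem_span_pos (x y : PathAlgebra k V)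
    (h : x ∈ Submodule.span k (ofPath '' {p : QPath V | 0 < p.length}) ∨
      y ∈ Submodule.span k (ofPath '' {p : QPath V | 0 < p.length})) :
    mulHom k V x y ∈ Submodule.span k (ofPath '' {p : QPath V | 0 < p.length}) := by
  have key : ∀ p q : QPath V, 0 < p.length ∨ 0 < q.length →
      pathMul k p q ∈ Submodule.span k (ofPath '' {p : QPath V | 0 < p.length}) := by
    intro p q hpq
    by_cases e : q.tgt = p.src
    · rw [pathMul_of_eq e]
      refine Submodule.subset_span ⟨_, ?_, rfl⟩
      change 0 < (p.comp q e).length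
      rw [QPath.length_comp]
      omega
    · rw [pathMul_of_ne e]
      exact Submodule.zero_mem _
  rcases h with h | h
  · refine Submodule.span_induction (p := fun x _ => mulHom k V x y ∈ _) ?_ ?_ ?_ ?_ h
    · rintro _ ⟨p, hp, rfl⟩
      refine induction_on y ?_ ?_ ?_
      · rw [map_zero]; exact Submodule.zero_mem _
      · intro c q
        rw [map_smul, mulHom_ofPath]
        exact Submodule.smul_mem _ _ (key p q (Or.inl hp))
      · intro a b ha hb
        rw [map_add]; exact Submodule.add_mem _ ha hb
    · rw [map_zero, LinearMap.zero_apply]; exact Submodule.zero_mem _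
    · intro a b _ _ ha hb
      rw [map_add, LinearMap.add_apply]; exact Submodule.add_mem _ ha hb
    · intro c a _ ha
      rw [map_smul, LinearMap.smul_apply]; exact Submodule.smul_mem _ _ ha
  · refine Submodule.span_induction (p := fun y _ => mulHom k V x y ∈ _) ?_ ?_ ?_ ?_ h
    · rintro _ ⟨q, hq, rfl⟩
      refine induction_on x ?_ ?_ ?_
      · rw [map_zero, LinearMap.zero_apply]; exact Submodule.zero_mem _
      · intro c p
        rw [map_smul, LinearMap.smul_apply, mulHom_ofPath]
        exact Submodule.smul_mem _ _ (key p q (Or.inr hq))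
      · intro a b ha hb
        rw [map_add, LinearMap.add_apply]; exact Submodule.add_mem _ ha hb
    · rw [map_zero]; exact Submodule.zero_mem _
    · intro a b _ _ ha hb
      rw [map_add]; exact Submodule.add_mem _ ha hb
    · intro c a _ ha
      rw [map_smul]; exact Submodule.smul_mem _ _ ha

variable (k V) in
/-- The arrow ideal: the two-sided ideal with basis the paths of positive length. -/
def arrowIdeal [Fintype V] : Ideal (PathAlgebra k V) where
  carrier := {x | ∀ p, x.coeff p ≠ 0 → 0 < p.length}
  zero_mem' := (mem_supported_iff {p | 0 < p.length} 0).2 (Submodule.zero_mem _)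
  add_mem' {x y} hx hy := (mem_supported_iff {p | 0 < p.length} (x + y)).2
    (Submodule.add_mem _ ((mem_supported_iff _ x).1 hx) ((mem_supported_iff _ y).1 hy))
  smul_mem' x y hy := (mem_supported_iff {p | 0 < p.length} (x * y)).2
    (mul_mem_span_pos x y (Or.inr ((mem_supported_iff _ y).1 hy)))

instance [Fintype V] : (arrowIdeal k V).IsTwoSided where
  mul_mem_of_left {x} y hx := (mem_supported_iff {p | 0 < p.length} (x * y)).2
    (mul_mem_span_pos x y (Or.inl ((mem_supported_iff _ x).1 hx)))

/-- A two-sided ideal `I` of a path algebra `k V` with arrow ideal `J` is admissible if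
`J ^ n ≤ I ≤ J ^ 2` for some `n ≥ 2` and `k V ⧸ I` is a projective `k`-module. -/
structure IsAdmissible [Fintype V] (I : Ideal (PathAlgebra k V)) [I.IsTwoSided] : Prop where
  pow_le : ∃ n : ℕ, 2 ≤ n ∧ arrowIdeal k V ^ n ≤ I
  le_sq : I ≤ arrowIdeal k V ^ 2
  projective : Module.Projective k (PathAlgebra k V ⧸ I)

/-! #### Change of scalars -/

section MapHom

variable {R : Type*} [CommRing R] (φ : R →+* k)

variable (V) in
/-- The canonical additive map `R V → k V` induced by a ring homomorphism `R → k`, applying it to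
the coefficients. -/
def mapHom : PathAlgebra R V →+ PathAlgebra k V :=
  Finsupp.mapRange.addMonoidHom φ.toAddMonoidHom

theorem mapHom_ofPath (p : QPath V) : mapHom V φ (ofPath p) = ofPath p := by
  refine (Finsupp.mapRange_single (hf := map_zero φ)).trans ?_
  exact congrArg (Finsupp.single p) (map_one φ)

theorem mapHom_pathMul (p q : QPath V) : mapHom V φ (pathMul R p q) = pathMul k p q := by
  by_cases h : q.tgt = p.src
  · rw [pathMul_of_eq h, pathMul_of_eq h, mapHom_ofPath]
  · rw [pathMul_of_ne h, pathMul_of_ne h, map_zero]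

theorem mapHom_smul (c : R) (x : PathAlgebra R V) :
    mapHom V φ (c • x) = φ c • mapHom V φ x :=
  Finsupp.ext fun p => map_mul φ c (x.coeff p)

theorem mapHom_mul [Fintype V] (x y : PathAlgebra R V) :
    mapHom V φ (x * y) = mapHom V φ x * mapHom V φ y := by
  change mapHom V φ (mulHom R V x y) = mulHom k V (mapHom V φ x) (mapHom V φ y)
  refine induction_on x ?_ ?_ ?_
  · simp only [map_zero, LinearMap.zero_apply]
  · intro c p
    refine induction_on y ?_ ?_ ?_
    · simp only [map_zero]
    · intro d q
      simp only [map_smul, LinearMap.smul_apply, mapHom_smul, mulHom_ofPath, mapHom_ofPath,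
        mapHom_pathMul]
    · intro a b ha hb
      simp only [map_add, ha, hb]
  · intro a b ha hb
    simp only [map_add, LinearMap.add_apply, ha, hb]

end MapHom

variable (k) in
/-- The canonical map `k ⊗ I → k V` for an ideal `I` of `ℤ V`, sending `c ⊗ x` to `c x`. -/
def tensorMap [Fintype V] (I : Ideal (PathAlgebra ℤ V)) : k ⊗[ℤ] I →ₗ[k] PathAlgebra k V :=
  LinearMap.liftBaseChange k
    (((mapHom V (Int.castRingHom k)).comp I.toAddSubgroup.subtype).toIntLinearMap)

theorem tensorMap_tmul [Fintype V] (I : Ideal (PathAlgebra ℤ V)) (c : k) (x : I) :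
    tensorMap k I (c ⊗ₜ[ℤ] x) = c • mapHom V (Int.castRingHom k) x.1 := rfl

theorem tensorMap_mul_left [Fintype V] (I : Ideal (PathAlgebra ℤ V)) (x : PathAlgebra k V)
    (t : k ⊗[ℤ] I) : x * tensorMap k I t ∈ LinearMap.range (tensorMap k I) := by
  induction t using TensorProduct.induction_on with
  | zero => rw [map_zero, mul_zero]; exact Submodule.zero_mem _
  | add s t hs ht => rw [map_add, mul_add]; exact Submodule.add_mem _ hs ht
  | tmul d y =>
    refine induction_on x ?_ ?_ ?_
    · rw [zero_mul]; exact Submodule.zero_mem _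
    · intro c p
      refine ⟨(c * d) ⊗ₜ[ℤ] ⟨ofPath p * y.1, I.mul_mem_left _ y.2⟩, ?_⟩
      rw [tensorMap_tmul, tensorMap_tmul, mapHom_mul, mapHom_ofPath, smul_mul_smul_comm]
    · intro a b ha hb
      rw [add_mul]; exact Submodule.add_mem _ ha hb

theorem tensorMap_mul_right [Fintype V] (I : Ideal (PathAlgebra ℤ V)) [I.IsTwoSided]
    (x : PathAlgebra k V) (t : k ⊗[ℤ] I) :
    tensorMap k I t * x ∈ LinearMap.range (tensorMap k I) := by
  induction t using TensorProduct.induction_on with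
  | zero => rw [map_zero, zero_mul]; exact Submodule.zero_mem _
  | add s t hs ht => rw [map_add, add_mul]; exact Submodule.add_mem _ hs ht
  | tmul d y =>
    refine induction_on x ?_ ?_ ?_
    · rw [mul_zero]; exact Submodule.zero_mem _
    · intro c p
      refine ⟨(d * c) ⊗ₜ[ℤ] ⟨y.1 * ofPath p, I.mul_mem_right _ y.2⟩, ?_⟩
      rw [tensorMap_tmul, tensorMap_tmul, mapHom_mul, mapHom_ofPath, smul_mul_smul_comm]
    · intro a b ha hb
      rw [mul_add]; exact Submodule.add_mem _ ha hb

variable (k) in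
/-- The ideal `k ⊗ I` of `k V`, that is, the image of `k ⊗ I` in `k V`. -/
def tensorIdeal [Fintype V] (I : Ideal (PathAlgebra ℤ V)) : Ideal (PathAlgebra k V) where
  carrier := LinearMap.range (tensorMap k I)
  zero_mem' := Submodule.zero_mem _
  add_mem' hx hy := Submodule.add_mem _ hx hy
  smul_mem' x y hy := by
    obtain ⟨t, rfl⟩ := hy
    exact tensorMap_mul_left I x t

instance [Fintype V] (I : Ideal (PathAlgebra ℤ V)) [I.IsTwoSided] :
    (tensorIdeal k I).IsTwoSided where
  mul_mem_of_left {x} y hx := by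
    obtain ⟨t, rfl⟩ := hx
    exact tensorMap_mul_right I y t

end PathAlgebra

/-! ### Bands -/

/-- A band is a semigroup in which each element is idempotent. -/
class Band (B : Type u) extends Semigroup B where
  mul_self : ∀ b : B, b * b = b

namespace Band

variable {B : Type u} [Band B]

/-- The principal ideal `B b B`. -/
def principalIdeal (b : B) : Set B := {x | ∃ c d : B, x = c * b * d}

variable (B) in
/-- The support semilattice `Λ(B)`: the set of principal ideals, ordered by inclusion. -/
abbrev SupportLattice : Type u := {X : Set B // ∃ b : B, principalIdeal b = X}

/-- The support map `σ : B → Λ(B)`. -/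
def supp (b : B) : SupportLattice B := ⟨principalIdeal b, b, rfl⟩

/-- Green's preorder `a ≤_R b`, that is, `a B ⊆ b B`, which for bands means `b a = a`. -/
def LeR (a b : B) : Prop := b * a = a

/-- Green's preorder `a ≤_L b`, that is, `B a ⊆ B b`, which for bands means `a b = a`. -/
def LeL (a b : B) : Prop := a * b = a

/-- The graph on `σ⁻¹(X)` in which distinct elements are adjacent if they have a common upper bound
for `≤_R`. -/
def fiberGraphR (X : SupportLattice B) : SimpleGraph {b : B // supp b = X} :=
  SimpleGraph.fromRel fun x y => ∃ c : B, LeR x.1 c ∧ LeR y.1 c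

/-- The graph on `σ⁻¹(X)` in which distinct elements are adjacent if they have a common upper bound
for `≤_L`. -/
def fiberGraphL (X : SupportLattice B) : SimpleGraph {b : B // supp b = X} :=
  SimpleGraph.fromRel fun x y => ∃ c : B, LeL x.1 c ∧ LeL y.1 c

variable (B) in
/-- A band is connected if all the graphs `fiberGraphR X` and `fiberGraphL X` are connected. -/
def IsConnected : Prop :=
  ∀ X : SupportLattice B, (fiberGraphR X).Connected ∧ (fiberGraphL X).Connected

/-- `L_X = σ⁻¹(X) ∩ B f_X`, where `f` picks an element `f_X ∈ σ⁻¹(X)` for each `X`. -/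
def LSet (f : SupportLattice B → B) (X : SupportLattice B) : Set B :=
  {a | supp a = X ∧ ∃ c : B, a = c * f X}

/-- `R_X = σ⁻¹(X) ∩ f_X B`, where `f` picks an element `f_X ∈ σ⁻¹(X)` for each `X`. -/
def RSet (f : SupportLattice B → B) (X : SupportLattice B) : Set B :=
  {a | supp a = X ∧ ∃ c : B, a = f X * c}

/-- The graph `Γ_R(Y, X)`, used for `X < Y`: its vertex set is `L_X`; each `a` is joined to each
`b a ≠ a` with `σ(b) ≥ Y`, and distinct `a`, `c` are joined if `a, c ≤_R b` for some `b` with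
`σ(b) ≱ Y`. -/
def gammaR (f : SupportLattice B → B) (Y X : SupportLattice B) : SimpleGraph (LSet f X) :=
  SimpleGraph.fromRel fun a c =>
    (∃ b : B, Y ≤ supp b ∧ c.1 = b * a.1) ∨
      ∃ b : B, LeR a.1 b ∧ LeR c.1 b ∧ ¬ Y ≤ supp b

/-- The graph `Γ_L(X, Y)`, used for `Y < X`: its vertex set is `R_Y`; each `a` is joined to each
`a b ≠ a` with `σ(b) ≥ X`, and distinct `a`, `c` are joined if `a, c ≤_L b` for some `b` with
`σ(b) ≱ X`. -/
def gammaL (f : SupportLattice B → B) (X Y : SupportLattice B) : SimpleGraph (RSet f Y) :=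
  SimpleGraph.fromRel fun a c =>
    (∃ b : B, X ≤ supp b ∧ c.1 = a.1 * b) ∨
      ∃ b : B, LeL a.1 b ∧ LeL c.1 b ∧ ¬ X ≤ supp b

open Classical in
/-- The number of arrows from `X` to `Y` in the quiver of a band. -/
def numArrows (f : SupportLattice B → B) (X Y : SupportLattice B) : ℕ :=
  if X < Y then Nat.card (gammaR f Y X).ConnectedComponent - 1
  else if Y < X then Nat.card (gammaL f X Y).ConnectedComponent - 1
  else 0

/-- The vertex set of the quiver `Q(B)`: it is `Λ(B)`, without its structure of a preorder
category. -/
def QuiverOf (_f : SupportLattice B → B) : Type u := SupportLattice B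

/-- The arrows of the quiver `Q(B)`: there are `numArrows f X Y` of them from `X` to `Y`. -/
instance (f : SupportLattice B → B) : Quiver.{0} (QuiverOf f) where
  Hom X Y := Fin (numArrows f X Y)

instance [Finite B] (f : SupportLattice B → B) : Fintype (QuiverOf f) :=
  have : Finite (QuiverOf f) := inferInstanceAs (Finite (SupportLattice B))
  Fintype.ofFinite _

end Band

end

/-!
The algebra of `B` embeds into the algebra `R` of the monoid obtained from `B` by adjoining an
identity. The supports of that monoid are `Λ(B)` together with a top element. Each support `X` gives a
character of `R`, namely `b ↦ 1` if `X ≤ σ(b)` and `b ↦ 0` otherwise. By Möbius inversion the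
characters identify the quotient of `R` by their common kernel `N` with a product of copies of `ℤ`,
and `N` is nilpotent because the elements of a fixed support form a rectangular band
(`IsSupportMap.exists_rad_pow_eq_bot`). Hence `1` is a sum of orthogonal idempotents `e_X` lifting the
standard ones (`IsSupportMap.exists_idempotents`).

The group `e_Y (N / N²) e_X` is dual to the derivations of the monoid, modulo the inner ones, into
abelian groups on which the monoid acts from the left by the character of `Y` and from the right by
that of `X`. These derivations can be computed by hand. For `X < Y` they are the functions on `L_X`
that are constant on the components of `Γ_R(Y, X)`, and the inner ones are the constants
(`hasDerivationBasis_of_graph`); the case `Y < X` is dual; in the remaining cases all derivations are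
inner. So `e_Y (N / N²) e_X` is free of rank the number of arrows from `X` to `Y`. If `X` or `Y` is the
top element, then the graph is connected because `B` is, and there are no arrows.

Sending the arrows to lifts of basis elements of `N / N²` in `e_Y N e_X` defines a homomorphism from
`ℤQ(B)` to the algebra of `B`. It is surjective because `N` is nilpotent, and it is injective modulo
the square of the arrow ideal because derivations vanish on `N²` (`IsSupportMap.exists_quiverRep`). As
the algebra of `B` is a free abelian group, the kernel `I` is a direct summand of `ℤQ(B)`, and
everything is compatible with change of scalars
(`QuiverRep.tensorMap_injective_and_mem_tensorIdeal_iff`).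
-/

noncomputable section

/-! ### Derivations of a band with values in a one-dimensional bimodule -/

/-- A derivation of `M` into `G`, where `M` acts on `G` from the left through `ψ` and from the right
through `χ`. In the applications `ψ` and `χ` are `{0, 1}`-valued characters. -/
def IsDerivation {M G : Type*} [Mul M] [AddCommGroup G] (ψ χ : M → ℤ) (D : M → G) : Prop :=
  ∀ a b, D (a * b) = ψ a • D b + χ b • D a

open Classical in
/-- The integer-valued indicator function of a predicate. -/
def ind {M : Type*} (U : M → Prop) (m : M) : ℤ := if U m then 1 else 0

theorem ind_of {M : Type*} {U : M → Prop} {m : M} (h : U m) : ind U m = 1 := if_pos h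

theorem ind_of_not {M : Type*} {U : M → Prop} {m : M} (h : ¬ U m) : ind U m = 0 := if_neg h

open Classical in
/-- The derivations for the characters `ψ` (left) and `χ` (right) modulo the inner ones
`b ↦ (χ b - ψ b) • m` are free on `ι`: there are integer-valued derivations `d i`, dual to the
differences `p i - q i`, such that each derivation `D` is, up to an inner one, the combination of the
`d i` with coefficients `D (p i) - D (q i)`.

The target groups range over one universe, which suffices because the definition is only applied to
quotients of the integral monoid algebra of `M`. -/
def HasDerivationBasis {M : Type u} [Mul M] (ι : Type) [Fintype ι] (ψ χ : M → ℤ) : Prop :=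
  ∃ (p q : ι → M) (d : ι → M → ℤ),
    (∀ i, IsDerivation ψ χ (d i)) ∧
    (∀ i, ψ (p i) = ψ (q i) ∧ χ (p i) = χ (q i)) ∧
    (∀ i j, d i (p j) - d i (q j) = if i = j then 1 else 0) ∧
    ∀ (G : Type u) [AddCommGroup G] (D : M → G), IsDerivation ψ χ D →
      ∃ m : G, ∀ b, D b = ∑ i, d i b • (D (p i) - D (q i)) + (χ b - ψ b) • m

/-- Passing to the opposite multiplication exchanges the left and the right character. -/
theorem HasDerivationBasis.of_op {M : Type u} [Mul M] {ι : Type} [Fintype ι] {ψ χ : M → ℤ}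
    (h : HasDerivationBasis (M := Mᵐᵒᵖ) ι (χ ∘ MulOpposite.unop) (ψ ∘ MulOpposite.unop)) :
    HasDerivationBasis ι ψ χ := by
  obtain ⟨p, q, d, hd, hpq, hdp, hD⟩ := h
  refine ⟨fun i => (p i).unop, fun i => (q i).unop, fun i b => d i (.op b), ?_, ?_, hdp, ?_⟩
  · intro i a b
    change d i (.op b * .op a) = _
    rw [hd i, add_comm]
    rfl
  · exact fun i => (hpq i).symm
  · intro G _ D hder
    obtain ⟨m, hm⟩ := hD G (fun b => D b.unop) (fun a b => by
      change D (b.unop * a.unop) = _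
      rw [hder, add_comm]
      rfl)
    refine ⟨-m, fun b => ?_⟩
    have := hm (.op b)
    simp only [MulOpposite.unop_op, Function.comp_apply] at this
    rw [this, smul_neg, ← neg_smul, neg_sub]

section Graph

variable {M : Type u} [Semigroup M] {U V : M → Prop}

/-- A derivation vanishes on the idempotents on which both characters agree: there
`D b = D (b * b)` reads `D b = 2 • D b` or `D b = 0`. -/
theorem IsDerivation.eq_zero_of_iff {G : Type*} [AddCommGroup G] (idem : ∀ a : M, a * a = a)
    {D : M → G} (hD : IsDerivation (ind V) (ind U) D) {b : M} (h : U b ↔ V b) : D b = 0 := by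
  have := hD b b
  rw [idem] at this
  by_cases hb : V b
  · rw [ind_of hb, ind_of (h.2 hb), one_smul] at this
    simpa using this
  · rw [ind_of_not hb, ind_of_not (h.not.2 hb), zero_smul, add_zero] at this
    exact this

theorem hasDerivationBasis_self (idem : ∀ a : M, a * a = a) (ι : Type) [Fintype ι] [IsEmpty ι] :
    HasDerivationBasis ι (ind U) (ind U) :=
  ⟨isEmptyElim, isEmptyElim, isEmptyElim, isEmptyElim, isEmptyElim, isEmptyElim,
    fun G _ D hD => ⟨0, fun b => by
      rw [hD.eq_zero_of_iff idem Iff.rfl, smul_zero, add_zero, Finset.univ_eq_empty,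
        Finset.sum_empty]⟩⟩

/-- For characters whose supports are incomparable, each derivation is inner: for `a` in `U` only
and `c` in `V` only, `c * a` lies in neither of them, so `0 = D (c * a) = D a + D c`. -/
theorem hasDerivationBasis_of_not_le (idem : ∀ a : M, a * a = a)
    (hU : ∀ a b, U (a * b) ↔ U a ∧ U b) (hV : ∀ a b, V (a * b) ↔ V a ∧ V b)
    {f g : M} (hfU : U f) (hfV : ¬ V f) (hgU : ¬ U g) (hgV : V g) (ι : Type) [Fintype ι] [IsEmpty ι] :
    HasDerivationBasis ι (ind V) (ind U) := by
  refine ⟨isEmptyElim, isEmptyElim, isEmptyElim, isEmptyElim, isEmptyElim, isEmptyElim,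
    fun G _ D hD => ⟨D f, fun b => ?_⟩⟩
  rw [Finset.univ_eq_empty, Finset.sum_empty, zero_add]
  have key : ∀ a c, U a → ¬ V a → ¬ U c → V c → D c = - D a := by
    intro a c h1 h2 h3 h4
    have h := hD c a
    rw [ind_of h1, ind_of h4, one_smul, one_smul, hD.eq_zero_of_iff idem (by rw [hU, hV]; tauto)] at h
    rw [eq_neg_iff_add_eq_zero, add_comm]
    exact h.symm
  by_cases h1 : U b <;> by_cases h2 : V b
  · rw [hD.eq_zero_of_iff idem (by tauto), ind_of h1, ind_of h2, sub_self, zero_smul]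
  · rw [ind_of h1, ind_of_not h2, sub_zero, one_smul, ← neg_inj, ← key b g h1 h2 hgU hgV,
      key f g hfU hfV hgU hgV]
  · rw [ind_of_not h1, ind_of h2, key f b hfU hfV h1 h2, zero_sub, neg_smul, one_smul]
  · rw [hD.eq_zero_of_iff idem (by tauto), ind_of_not h1, ind_of_not h2, sub_self, zero_smul]

open Classical in
/-- Let `V` imply `U`. A derivation `D` vanishes off `U ∧ ¬ V`, satisfies `D b = D (b * f)` on
`U ∧ ¬ V`, and is constant on the connected components of `G`, a graph on the set `{v t}` of elements
of the form `b * f` with `U b`. The derivations are therefore free on the components; modulo the inner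
derivation `χ - ψ`, which is the sum of all basis elements, one component becomes redundant. -/
theorem hasDerivationBasis_of_graph (idem : ∀ a : M, a * a = a)
    (hU : ∀ a b, U (a * b) ↔ U a ∧ U b) (hV : ∀ a b, V (a * b) ↔ V a ∧ V b)
    (hVU : ∀ a, V a → U a) {T : Type*} [Finite T] {v : T → M} (hv : Function.Injective v)
    {f : M} (hvU : ∀ t, U (v t)) (hvV : ∀ t, ¬ V (v t)) (hfU : U f) (hfV : ¬ V f)
    (hvf : ∀ t, v t * f = v t) (hvr : ∀ b, U b → ∃ t, v t = b * f) (G : SimpleGraph T)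
    (reach₁ : ∀ s t b, V b → v t = b * v s → G.Reachable s t)
    (reach₂ : ∀ s t b, ¬ V b → b * v s = v s → b * v t = v t → G.Reachable s t)
    (adj : ∀ s t, G.Adj s t → (∃ b, V b ∧ v t = b * v s) ∨ (∃ b, V b ∧ v s = b * v t) ∨
      ∃ b, ¬ V b ∧ b * v s = v s ∧ b * v t = v t)
    (ι : Type) [Fintype ι] (hι : Nat.card ι = Nat.card G.ConnectedComponent - 1) :
    HasDerivationBasis ι (ind V) (ind U) := by
  obtain ⟨t₀, ht₀⟩ := hvr f hfU
  rw [idem] at ht₀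
  have hr' : ∀ b, ∃ t, U b → v t = b * f := fun b => by
    by_cases h : U b
    · obtain ⟨t, ht⟩ := hvr b h
      exact ⟨t, fun _ => ht⟩
    · exact ⟨t₀, fun h' => absurd h' h⟩
  choose r hr using hr'
  have hrv : ∀ t, r (v t) = t := fun t => hv (by rw [hr _ (hvU t), hvf])
  set C₀ := G.connectedComponentMk t₀ with hC₀
  have hcard : Nat.card ι = Nat.card {C : G.ConnectedComponent // C ≠ C₀} := by
    rw [hι]
    have := Fintype.ofFinite G.ConnectedComponent
    rw [Nat.card_eq_fintype_card, Nat.card_eq_fintype_card, Fintype.card_subtype_compl,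
      Fintype.card_subtype_eq]
  let e : ι ≃ {C : G.ConnectedComponent // C ≠ C₀} := Classical.choice (Finite.card_eq.1 hcard)
  choose rep hrep using fun C : G.ConnectedComponent => C.exists_rep
  -- the derivation that is `1` on the elements of `U ∧ ¬ V` whose component is `C`
  let δ : G.ConnectedComponent → M → ℤ := fun C b =>
    ind (fun b => U b ∧ ¬ V b ∧ G.connectedComponentMk (r b) = C) b
  have hδv : ∀ C t, δ C (v t) = if G.connectedComponentMk t = C then 1 else 0 := by
    intro C t
    simp only [δ, ind, hrv, hvU, hvV, not_false_eq_true, true_and]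
  -- `b * c` has the component of `c` if `V b`, and that of `b` otherwise
  have hcV : ∀ b c, V b → U c → ¬ V c →
      G.connectedComponentMk (r (b * c)) = G.connectedComponentMk (r c) := by
    intro b c hb hc hc'
    refine SimpleGraph.ConnectedComponent.eq.2 (SimpleGraph.Reachable.symm ?_)
    refine reach₁ _ _ b hb ?_
    rw [hr _ ((hU _ _).2 ⟨hVU _ hb, hc⟩), hr _ hc, mul_assoc]
  have hcU : ∀ b c, U b → ¬ V b → U c →
      G.connectedComponentMk (r (b * c)) = G.connectedComponentMk (r b) := by
    intro b c hb hb' hc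
    refine SimpleGraph.ConnectedComponent.eq.2 (reach₂ _ _ b hb' ?_ ?_)
    · rw [hr _ ((hU _ _).2 ⟨hb, hc⟩), mul_assoc, ← mul_assoc, idem]
    · rw [hr _ hb, ← mul_assoc, idem]
  have hδ : ∀ C, IsDerivation (ind V) (ind U) (δ C) := by
    intro C b c
    by_cases hb : U b
    · by_cases hc : U c
      · by_cases hb' : V b
        · by_cases hc' : V c
          · simp [δ, ind, hU, hV, hb, hb', hc, hc']
          · simp [δ, ind, hU, hV, hb, hb', hc, hc', hcV b c hb' hc hc']
        · simp [δ, ind, hU, hV, hb, hb', hc, hcU b c hb hb' hc]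
      · have hc' : ¬ V c := fun h => hc (hVU _ h)
        simp [δ, ind, hU, hV, hb, hc, hc']
    · have hb' : ¬ V b := fun h => hb (hVU _ h)
      simp [δ, ind, hU, hb, hb']
  refine ⟨fun i => v (rep (e i).1), fun _ => f, fun i => δ (e i).1, fun i => hδ _, fun i => ?_,
    fun i j => ?_, fun H _ D hD => ⟨D f, fun b => ?_⟩⟩
  · rw [ind_of_not (hvV _), ind_of_not hfV, ind_of (hvU _), ind_of hfU]
    exact ⟨rfl, rfl⟩
  · change δ _ (v _) - δ _ f = _
    rw [← ht₀, hδv, hδv, if_neg (e i).2.symm, sub_zero]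
    have : G.connectedComponentMk (rep (e j).1) = (e j).1 := hrep _
    rw [this]
    simp only [Subtype.val_inj, e.injective.eq_iff, eq_comm]
  · have hconst : ∀ s t, G.Reachable s t → D (v s) = D (v t) := by
      have h1 : ∀ s t b, V b → v t = b * v s → D (v s) = D (v t) := by
        intro s t b hb h
        rw [h, hD, ind_of hb, ind_of (hvU s), one_smul, one_smul,
          hD.eq_zero_of_iff idem ⟨fun _ => hb, fun _ => hVU _ hb⟩, add_zero]
      have h2 : ∀ t b, ¬ V b → b * v t = v t → D (v t) = D b := by
        intro t b hb h
        rw [← h, hD, ind_of_not hb, ind_of (hvU t), zero_smul, one_smul, zero_add]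
      rintro s t ⟨p⟩
      induction p with
      | nil => rfl
      | cons h _ ih =>
        rw [← ih]
        rcases adj _ _ h with ⟨b, hb, h⟩ | ⟨b, hb, h⟩ | ⟨b, hb, h, h'⟩
        · exact h1 _ _ b hb h
        · exact (h1 _ _ b hb h).symm
        · rw [h2 _ b hb h, h2 _ b hb h']
    have hDrep : ∀ t, D (v (rep (G.connectedComponentMk t))) = D (v t) := fun t =>
      hconst _ _ (SimpleGraph.ConnectedComponent.exact (hrep _))
    by_cases hb : U b ∧ ¬ V b
    · have hDb : D b = D (v (r b)) := by
        rw [hr b hb.1, hD, ind_of_not hb.2, ind_of hfU, zero_smul, one_smul, zero_add]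
      have hδb : ∀ C, δ C b = if G.connectedComponentMk (r b) = C then 1 else 0 := fun C => by
        simp only [δ, ind, hb.1, hb.2, not_false_eq_true, true_and]
      rw [ind_of hb.1, ind_of_not hb.2, sub_zero, one_smul, ← sub_eq_iff_eq_add, hDb, ← hDrep]
      simp only [hδb]
      by_cases h0 : G.connectedComponentMk (r b) = C₀
      · rw [Finset.sum_eq_zero, h0, hDrep, ht₀, sub_self]
        intro i _
        rw [h0, if_neg (e i).2.symm, zero_smul]
      · rw [Finset.sum_eq_single (e.symm ⟨_, h0⟩)]
        · rw [Equiv.apply_symm_apply, if_pos rfl, one_smul]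
        · intro i _ hi
          rw [if_neg, zero_smul]
          rintro h
          exact hi (e.injective (by rw [Equiv.apply_symm_apply]; exact Subtype.ext h.symm))
        · exact fun h => absurd (Finset.mem_univ _) h
    · have hb' : U b ↔ V b := ⟨fun h => by tauto, hVU b⟩
      rw [hD.eq_zero_of_iff idem hb', Finset.sum_eq_zero, zero_add]
      · have : ind U b = ind V b := by simp [ind, hb']
        rw [this, sub_self, zero_smul]
      · intro i _
        change δ _ b • _ = _
        rw [(hδ _).eq_zero_of_iff idem hb', zero_smul]

/-- `hasDerivationBasis_of_graph` for the graph of a relation which is given, off the diagonal, by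
the two kinds of edges. -/
theorem hasDerivationBasis_fromRel (idem : ∀ a : M, a * a = a)
    (hU : ∀ a b, U (a * b) ↔ U a ∧ U b) (hV : ∀ a b, V (a * b) ↔ V a ∧ V b)
    (hVU : ∀ a, V a → U a) {T : Type*} [Finite T] {v : T → M} (hv : Function.Injective v)
    {f : M} (hvU : ∀ t, U (v t)) (hvV : ∀ t, ¬ V (v t)) (hfU : U f) (hfV : ¬ V f)
    (hvf : ∀ t, v t * f = v t) (hvr : ∀ b, U b → ∃ t, v t = b * f) (r : T → T → Prop)
    (hrel : ∀ s t, s ≠ t → (r s t ↔ (∃ b, V b ∧ v t = b * v s) ∨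
      ∃ b, b * v s = v s ∧ b * v t = v t ∧ ¬ V b))
    (ι : Type) [Fintype ι]
    (hι : Nat.card ι = Nat.card (SimpleGraph.fromRel r).ConnectedComponent - 1) :
    HasDerivationBasis ι (ind V) (ind U) := by
  have reach : ∀ s t, (s ≠ t → r s t) → (SimpleGraph.fromRel r).Reachable s t := by
    intro s t h
    rcases eq_or_ne s t with rfl | hne
    · rfl
    · exact SimpleGraph.Adj.reachable ((SimpleGraph.fromRel_adj _ _ _).2 ⟨hne, Or.inl (h hne)⟩)
  refine hasDerivationBasis_of_graph idem hU hV hVU hv hvU hvV hfU hfV hvf hvr _ ?_ ?_ ?_ ι hι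
  · exact fun s t b hb h => reach s t fun hne => (hrel s t hne).2 (Or.inl ⟨b, hb, h⟩)
  · exact fun s t b hb h h' => reach s t fun hne => (hrel s t hne).2 (Or.inr ⟨b, h, h', hb⟩)
  · intro s t h
    obtain ⟨hne, h | h⟩ := (SimpleGraph.fromRel_adj _ _ _).1 h
    · rcases (hrel s t hne).1 h with h | ⟨b, h, h', hb⟩
      · exact Or.inl h
      · exact Or.inr (Or.inr ⟨b, hb, h, h'⟩)
    · rcases (hrel t s hne.symm).1 h with h | ⟨b, h, h', hb⟩
      · exact Or.inr (Or.inl h)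
      · exact Or.inr (Or.inr ⟨b, hb, h', h⟩)

end Graph

/-! ### The algebra of a monoid over its support semilattice -/

/-- The properties of the support map of a finite monoid of idempotents that the description of its
algebra uses: `s` is a surjection onto a poset which turns products into meets, and elements of equal
support absorb every factor of larger support that stands between them. -/
structure IsSupportMap {M Ω : Type*} [Monoid M] [PartialOrder Ω] (s : M → Ω) : Prop where
  surjective : Function.Surjective s
  le_mul_iff : ∀ {ω a b}, ω ≤ s (a * b) ↔ ω ≤ s a ∧ ω ≤ s b
  le_one : ∀ ω, ω ≤ s 1
  mul_mul_eq : ∀ {a b c}, s a = s c → s a ≤ s b → a * b * c = a * c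

namespace IsSupportMap

variable {M : Type u} {Ω : Type v} [Monoid M] [PartialOrder Ω] {s : M → Ω} (hs : IsSupportMap s)

open MonoidAlgebra

/-- The character of the monoid algebra that sends `m` to `1` if `ω ≤ s m` and to `0` otherwise. -/
def chi (ω : Ω) : MonoidAlgebra ℤ M →+* ℤ :=
  (MonoidAlgebra.lift ℤ ℤ M
    { toFun := ind fun m => ω ≤ s m
      map_one' := ind_of (hs.le_one ω)
      map_mul' := fun a b => by
        by_cases ha : ω ≤ s a <;> by_cases hb : ω ≤ s b <;>
          simp [ind, hs.le_mul_iff, ha, hb] } : MonoidAlgebra ℤ M →ₐ[ℤ] ℤ).toRingHom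

theorem chi_of (ω : Ω) (m : M) : hs.chi ω (of ℤ M m) = ind (fun m => ω ≤ s m) m :=
  MonoidAlgebra.lift_of _ _

theorem chi_of_le {ω : Ω} {m : M} (h : ω ≤ s m) : hs.chi ω (of ℤ M m) = 1 :=
  (hs.chi_of ω m).trans (ind_of h)

theorem chi_of_not_le {ω : Ω} {m : M} (h : ¬ ω ≤ s m) : hs.chi ω (of ℤ M m) = 0 :=
  (hs.chi_of ω m).trans (ind_of_not h)

/-- The common kernel of the characters `chi ω`. It is a two-sided ideal, but it is encoded as a
`ℤ`-submodule so that sums, products and powers of submodules of the algebra are available. -/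
def rad : Submodule ℤ (MonoidAlgebra ℤ M) where
  carrier := {x | ∀ ω, hs.chi ω x = 0}
  zero_mem' ω := map_zero _
  add_mem' hx hy ω := by rw [map_add, hx, hy, add_zero]
  smul_mem' c x hx ω := by rw [map_zsmul, hx, smul_zero]

theorem mul_mem_rad_left (x : MonoidAlgebra ℤ M) {y} (hy : y ∈ hs.rad) : x * y ∈ hs.rad :=
  fun ω => by rw [map_mul, hy, mul_zero]

/-- The span of the elements whose support has at most `j` elements below it. -/
def filt (s : M → Ω) (j : ℕ) : Submodule ℤ (MonoidAlgebra ℤ M) :=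
  Submodule.span ℤ (of ℤ M '' {m | (Set.Iic (s m)).ncard ≤ j})

theorem ncard_Iic_lt [Finite Ω] {ω ω' : Ω} (h : ω < ω') : (Set.Iic ω).ncard < (Set.Iic ω').ncard :=
  Set.ncard_lt_ncard (Set.Iic_ssubset_Iic.2 h) (Set.toFinite _)

theorem of_mem_filt {m : M} {j : ℕ} (h : (Set.Iic (s m)).ncard ≤ j) : of ℤ M m ∈ filt s j :=
  Submodule.subset_span ⟨m, h, rfl⟩

theorem mul_le_left (hs : IsSupportMap s) (a b : M) : s (a * b) ≤ s a := (hs.le_mul_iff.1 le_rfl).1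
theorem mul_le_right (hs : IsSupportMap s) (a b : M) : s (a * b) ≤ s b := (hs.le_mul_iff.1 le_rfl).2

/-- If `b` and `c` have the same support, then `b * m * c` is `b * c` for `m` of larger support, and
has smaller support otherwise. -/
theorem of_mul_mul_of_sub_mem [Finite Ω] {j : ℕ} {b c : M} (hb : (Set.Iic (s b)).ncard ≤ j + 1)
    (hc : (Set.Iic (s c)).ncard ≤ j + 1) (x : MonoidAlgebra ℤ M) :
    of ℤ M b * x * of ℤ M c - hs.chi (s b) x • of ℤ M (b * c) ∈ filt s j := by
  induction x using MonoidAlgebra.induction_on with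
  | of m =>
    have lt : ∀ z, s z ≤ s b → s z ≤ s c → ¬ (s z = s b ∧ s z = s c) → of ℤ M z ∈ filt s j := by
      intro z h1 h2 h3
      refine of_mem_filt ?_
      by_cases h : s z = s b
      · have := ncard_Iic_lt (lt_of_le_of_ne h2 fun h' => h3 ⟨h, h'⟩)
        omega
      · have := ncard_Iic_lt (lt_of_le_of_ne h1 h)
        omega
    rw [← map_mul, ← map_mul]
    have hbm : s (b * m * c) ≤ s b := (hs.mul_le_left _ _).trans (hs.mul_le_left _ _)
    by_cases h : s (b * m * c) = s b ∧ s (b * m * c) = s c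
    · have hm : s b ≤ s m := h.1 ▸ (hs.mul_le_left _ _).trans (hs.mul_le_right _ _)
      rw [hs.chi_of_le hm, hs.mul_mul_eq (h.1.symm.trans h.2) hm, one_smul, sub_self]
      exact Submodule.zero_mem _
    · refine Submodule.sub_mem _ (lt _ hbm (hs.mul_le_right _ _) h) ?_
      by_cases hm : s b ≤ s m
      · refine Submodule.smul_mem _ _ (lt _ (hs.mul_le_left _ _) (hs.mul_le_right _ _) fun h' => ?_)
        have e : s b = s c := h'.1.symm.trans h'.2
        rw [hs.mul_mul_eq e hm] at h
        exact h h'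
      · rw [hs.chi_of_not_le hm, zero_smul]
        exact Submodule.zero_mem _
  | add x y hx hy =>
    have := Submodule.add_mem _ hx hy
    rw [map_add, add_smul, mul_add, add_mul]
    convert this using 1
    abel
  | smul c x hx =>
    rw [map_zsmul, smul_assoc, mul_smul_comm, smul_mul_assoc, ← smul_sub]
    exact Submodule.smul_mem _ _ hx

theorem filt_mul_rad_mul_filt [Finite Ω] (j : ℕ) : filt s (j + 1) * hs.rad * filt s (j + 1) ≤ filt s j := by
  rw [filt, filt, Submodule.mul_le]
  intro y hy z hz
  refine Submodule.span_induction (p := fun z _ => y * z ∈ _) ?_ ?_ ?_ ?_ hz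
  · rintro _ ⟨c, hc, rfl⟩
    revert y
    change _ ≤ Submodule.comap (LinearMap.mulRight ℤ (of ℤ M c)) (filt s j)
    rw [Submodule.mul_le]
    intro w hw x hx
    refine Submodule.span_induction (p := fun w _ => w * x ∈ _) ?_ ?_ ?_ ?_ hw
    · rintro _ ⟨b, hb, rfl⟩
      have := hs.of_mul_mul_of_sub_mem hb hc x
      rwa [hx, zero_smul, sub_zero] at this
    · rw [zero_mul]; exact Submodule.zero_mem _
    · intro a b _ _ ha hb
      rw [add_mul]; exact Submodule.add_mem _ ha hb
    · intro c a _ ha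
      rw [smul_mul_assoc]; exact Submodule.smul_mem _ _ ha
  · rw [mul_zero]; exact Submodule.zero_mem _
  · intro a b _ _ ha hb
    rw [mul_add]; exact Submodule.add_mem _ ha hb
  · intro c a _ ha
    rw [mul_smul_comm]; exact Submodule.smul_mem _ _ ha

/-- The radical is nilpotent, since `rad ^ n ≤ filt s (j + 1)` implies
`rad ^ (n + 1 + n) ≤ filt s j`. -/
theorem exists_rad_pow_eq_bot [Finite Ω] : ∃ n, 2 ≤ n ∧ hs.rad ^ n = ⊥ := by
  have key : ∀ k : ℕ, ∃ n, 2 ≤ n ∧ hs.rad ^ n ≤ filt s (Nat.card Ω - k) := by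
    intro k
    induction k with
    | zero =>
      suffices h : ∀ x, x ∈ filt s (Nat.card Ω - 0) from ⟨2, le_rfl, fun x _ => h x⟩
      intro x
      induction x using MonoidAlgebra.induction_on with
      | of m => exact of_mem_filt (by rw [← Set.ncard_univ]; exact Set.ncard_le_ncard (Set.subset_univ _))
      | add x y hx hy => exact Submodule.add_mem _ hx hy
      | smul c x hx => exact Submodule.smul_mem _ _ hx
    | succ k ih =>
      obtain ⟨n, hn, h⟩ := ih
      rcases Nat.eq_zero_or_pos (Nat.card Ω - k) with h0 | h0
      · exact ⟨n, hn, by rwa [show Nat.card Ω - (k + 1) = Nat.card Ω - k by omega]⟩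
      · refine ⟨n + 1 + n, by omega, ?_⟩
        obtain ⟨j, hj⟩ : ∃ j, Nat.card Ω - k = j + 1 := ⟨_, (Nat.succ_pred_eq_of_pos h0).symm⟩
        have hj' : Nat.card Ω - (k + 1) = j := by omega
        rw [hj] at h
        rw [hj', pow_add, pow_succ]
        exact (mul_le_mul' (mul_le_mul' h le_rfl) h).trans (hs.filt_mul_rad_mul_filt j)
  obtain ⟨n, hn, h⟩ := key (Nat.card Ω)
  refine ⟨n, hn, ?_⟩
  rw [eq_bot_iff]
  refine h.trans ?_
  rw [Nat.sub_self, filt, Submodule.span_le]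
  rintro _ ⟨m, hm, rfl⟩
  have : (Set.Iic (s m)).ncard = 0 := Nat.le_zero.1 hm
  rw [Set.ncard_eq_zero (Set.toFinite _)] at this
  exact absurd this Set.nonempty_Iic.ne_empty

open Classical in
/-- The idempotents of `Ω → ℤ` lift along `chi`: Möbius inversion shows that `chi` is surjective, and
its kernel is nilpotent. -/
theorem exists_idempotents [Fintype Ω] : ∃ e : Ω → MonoidAlgebra ℤ M,
    CompleteOrthogonalIdempotents e ∧ ∀ ω ω', hs.chi ω (e ω') = if ω = ω' then 1 else 0 := by
  have hδ : ∀ ω, ∃ x, ∀ ω', hs.chi ω' x = if ω' = ω then 1 else 0 := by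
    intro ω
    induction ω using WellFoundedLT.induction with
    | ind ω ih =>
      choose! x hx using ih
      obtain ⟨m, rfl⟩ := hs.surjective ω
      refine ⟨of ℤ M m - ∑ ω' ∈ Finset.univ.filter (· < s m), x ω', fun ω' => ?_⟩
      rw [map_sub, map_sum, hs.chi_of,
        Finset.sum_congr rfl fun a ha => hx a (Finset.mem_filter.1 ha).2 ω', Finset.sum_ite_eq]
      simp only [ind, Finset.mem_filter, Finset.mem_univ, true_and]
      rcases eq_or_ne ω' (s m) with h | h
      · simp [h]
      · simp [h, lt_iff_le_and_ne]
  choose x hx using hδ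
  have hnil : ∀ y ∈ RingHom.ker (RingHom.pi hs.chi), IsNilpotent y := by
    intro y hy
    obtain ⟨n, -, hn⟩ := hs.exists_rad_pow_eq_bot
    have hy' : y ∈ hs.rad := fun ω => congrFun hy ω
    exact ⟨n, (Submodule.mem_bot ℤ).1 (hn ▸ Submodule.pow_mem_pow _ hy' n)⟩
  obtain ⟨e, he, hee⟩ := CompleteOrthogonalIdempotents.lift_of_isNilpotent_ker
    (RingHom.pi hs.chi) hnil (CompleteOrthogonalIdempotents.single fun _ : Ω => ℤ) (fun ω =>
      ⟨x ω, funext fun ω' => (hx ω ω').trans (Pi.single_apply ω (1 : ℤ) ω').symm⟩)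
  refine ⟨e, he, fun ω ω' => ?_⟩
  have := congrFun (congrFun hee ω') ω
  exact this.trans (Pi.single_apply ω' (1 : ℤ) ω)

end IsSupportMap

/-! ### Representations of quivers and their values on paths -/

/-- The data defining an algebra homomorphism from the path algebra of `V` to `A`: orthogonal
idempotents of `A` for the vertices, and elements of the corresponding Peirce components for the
arrows. The sum of the idempotents is not required to be an identity of `A`, which may be
non-unital. -/
structure QuiverRep (V : Type u) [Quiver.{v} V] (A : Type w) [NonUnitalRing A] where
  vert : V → A
  arr : ∀ {X Y : V}, (X ⟶ Y) → A
  vert_mul_self : ∀ X, vert X * vert X = vert X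
  vert_mul_of_ne : ∀ {X Y}, X ≠ Y → vert X * vert Y = 0
  vert_mul_arr : ∀ {X Y} (a : X ⟶ Y), vert Y * arr a = arr a
  arr_mul_vert : ∀ {X Y} (a : X ⟶ Y), arr a * vert X = arr a

namespace QuiverRep

variable {V : Type u} [Quiver.{v} V] {A : Type w} [NonUnitalRing A] (ρ : QuiverRep V A)

/-- The value of a path. Since products of paths are written from right to left, the last arrow comes
first. -/
def evalPath {X : V} : ∀ {Y : V}, Quiver.Path X Y → A
  | _, .nil => ρ.vert X
  | _, .cons p a => ρ.arr a * evalPath p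

theorem vert_mul_evalPath {X Y : V} (p : Quiver.Path X Y) :
    ρ.vert Y * ρ.evalPath p = ρ.evalPath p := by
  cases p with
  | nil => exact ρ.vert_mul_self X
  | cons p a => rw [evalPath, ← mul_assoc, ρ.vert_mul_arr]

theorem evalPath_mul_vert {X Y : V} (p : Quiver.Path X Y) :
    ρ.evalPath p * ρ.vert X = ρ.evalPath p := by
  induction p with
  | nil => exact ρ.vert_mul_self X
  | cons p a ih => rw [evalPath, mul_assoc, ih]

theorem evalPath_comp {X Y Z : V} (q : Quiver.Path X Y) (p : Quiver.Path Y Z) :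
    ρ.evalPath (q.comp p) = ρ.evalPath p * ρ.evalPath q := by
  induction p with
  | nil => exact (ρ.vert_mul_evalPath q).symm
  | cons p a ih => rw [Quiver.Path.comp_cons, evalPath, evalPath, ih, mul_assoc]

/-- The value of a path whose end points are bundled. -/
def eval (p : QPath V) : A := ρ.evalPath p.path

theorem eval_comp (p q : QPath V) (h : q.tgt = p.src) :
    ρ.eval (p.comp q h) = ρ.eval p * ρ.eval q := by
  obtain ⟨a, b, p⟩ := p
  obtain ⟨c, d, q⟩ := q
  obtain rfl : d = a := h
  exact ρ.evalPath_comp q p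

theorem eval_mul_of_ne {p q : QPath V} (h : q.tgt ≠ p.src) : ρ.eval p * ρ.eval q = 0 := by
  rw [eval, eval, ← ρ.evalPath_mul_vert p.path, ← ρ.vert_mul_evalPath q.path, mul_assoc,
    ← mul_assoc (ρ.vert _) (ρ.vert _), ρ.vert_mul_of_ne h.symm, zero_mul, mul_zero]

/-- The linear map from the path algebra to a semigroup algebra given by a representation of the
quiver in the latter. -/
def evalLin {k S : Type*} [CommRing k] [Semigroup S] (ρ : QuiverRep V (MonoidAlgebra k S)) :
    PathAlgebra k V →ₗ[k] MonoidAlgebra k S :=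
  Finsupp.linearCombination k ρ.eval

theorem evalLin_ofPath {k S : Type*} [CommRing k] [Semigroup S]
    (ρ : QuiverRep V (MonoidAlgebra k S)) (p : QPath V) :
    ρ.evalLin (PathAlgebra.ofPath p) = ρ.eval p :=
  (Finsupp.linearCombination_single k 1 p).trans (one_smul k _)

theorem eval_mem_pow {R : Type w} [Ring R] (ρ : QuiverRep V R) {N : Submodule ℤ R}
    (h : ∀ {X Y : V} (a : X ⟶ Y), ρ.arr a ∈ N) (p : QPath V) (hp : 0 < p.length) :
    ρ.eval p ∈ N ^ p.length := by
  obtain ⟨X, Y, p⟩ := p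
  change 0 < p.length at hp
  change ρ.evalPath p ∈ N ^ p.length
  induction p with
  | nil => exact absurd hp (lt_irrefl 0)
  | cons p a ih =>
    rw [evalPath, Quiver.Path.length_cons, pow_succ']
    cases p with
    | nil =>
      rw [evalPath, ρ.arr_mul_vert, Quiver.Path.length_nil, pow_zero, mul_one]
      exact h a
    | cons q b => exact Submodule.mul_mem_mul (h a) (ih (Nat.succ_pos _))

end QuiverRep

/-! ### Derivations modulo the square of the radical -/

namespace IsSupportMap

variable {M : Type u} {Ω : Type v} [Monoid M] [PartialOrder Ω] {s : M → Ω} (hs : IsSupportMap s)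

open MonoidAlgebra

section Derivation

variable {G : Type*} [AddCommGroup G]

/-- The linear extension to the monoid algebra of a function on the monoid. -/
def linExt (D : M → G) : MonoidAlgebra ℤ M →ₗ[ℤ] G where
  toFun x := Finsupp.linearCombination ℤ D x.coeff
  map_add' x y := by rw [coeff_add, map_add]
  map_smul' c x := by rw [coeff_smul, map_smul, RingHom.id_apply]

theorem linExt_of (D : M → G) (m : M) : linExt D (of ℤ M m) = D m :=
  (Finsupp.linearCombination_single ℤ 1 m).trans (one_smul ℤ _)

theorem linExt_mul {D : M → G} {X Y : Ω}
    (hD : IsDerivation (ind fun m => Y ≤ s m) (ind fun m => X ≤ s m) D) (x y : MonoidAlgebra ℤ M) :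
    linExt D (x * y) = hs.chi Y x • linExt D y + hs.chi X y • linExt D x := by
  induction x using MonoidAlgebra.induction_on with
  | of a =>
    induction y using MonoidAlgebra.induction_on with
    | of b => rw [← map_mul, linExt_of, linExt_of, linExt_of, hs.chi_of, hs.chi_of, hD]
    | add x y hx hy => rw [mul_add, map_add, map_add, map_add, hx, hy]; module
    | smul c x hx => rw [mul_smul_comm, map_smul, map_smul (linExt D), map_zsmul (hs.chi _), hx]; module
  | add x y hx hy => rw [add_mul, map_add, map_add, map_add, hx, hy]; module
  | smul c x hx => rw [smul_mul_assoc, map_smul, map_smul (linExt D), map_zsmul (hs.chi _), hx]; module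

theorem linExt_eq_zero_of_mem {D : M → G} {X Y : Ω}
    (hD : IsDerivation (ind fun m => Y ≤ s m) (ind fun m => X ≤ s m) D) {x : MonoidAlgebra ℤ M}
    (hx : x ∈ hs.rad * hs.rad) : linExt D x = 0 := by
  revert x
  change _ ≤ LinearMap.ker (linExt D)
  rw [Submodule.mul_le]
  intro x hx y hy
  rw [LinearMap.mem_ker, hs.linExt_mul hD, hx, hy, zero_smul, zero_smul, add_zero]

end Derivation

/-- For `x` in the radical, `eY * x * eX` is, modulo the square of the radical, a combination of the
elements `eY * (p i - q i) * eX` given by a basis of derivations. Indeed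
`m ↦ eY * (m * eX - chi X m • eX)` is a derivation modulo the square of the radical; its linear
extension sends `x` to `eY * x * eX`, and the inner derivations vanish at `x`. -/
theorem mul_mul_mem_span_sup {X Y : Ω} {eX eY : MonoidAlgebra ℤ M}
    (heY : ∀ ω, ω ≠ Y → hs.chi ω eY = 0)
    (heX : ∀ ω, ω ≠ X → hs.chi ω eX = 0)
    {ι : Type} [Fintype ι] {p q : ι → M} {d : ι → M → ℤ}
    (hpq : ∀ i, ind (fun m => X ≤ s m) (p i) = ind (fun m => X ≤ s m) (q i))
    (h : ∀ (G : Type u) [AddCommGroup G] (D : M → G),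
      IsDerivation (ind fun m => Y ≤ s m) (ind fun m => X ≤ s m) D →
      ∃ m : G, ∀ b, D b = ∑ i, d i b • (D (p i) - D (q i)) +
        (ind (fun m => X ≤ s m) b - ind (fun m => Y ≤ s m) b) • m)
    {x : MonoidAlgebra ℤ M} (hx : x ∈ hs.rad) :
    eY * x * eX ∈ Submodule.span ℤ (Set.range fun i => eY * (of ℤ M (p i) - of ℤ M (q i)) * eX) ⊔
      hs.rad * hs.rad := by
  let Q := (hs.rad * hs.rad).mkQ
  let F : MonoidAlgebra ℤ M →ₗ[ℤ] (MonoidAlgebra ℤ M ⧸ hs.rad * hs.rad) :=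
    linExt fun b => Q (eY * (of ℤ M b * eX - ind (fun m => X ≤ s m) b • eX))
  have hF : ∀ x, F x = Q (eY * (x * eX - hs.chi X x • eX)) := by
    intro x
    induction x using MonoidAlgebra.induction_on with
    | of a => rw [hs.chi_of]; exact linExt_of _ _
    | add x y hx hy =>
      rw [map_add, hx, hy, ← map_add Q, map_add (hs.chi X), add_smul, ← mul_add, add_mul,
        add_sub_add_comm]
    | smul c x hx =>
      rw [map_smul, hx, ← map_smul Q, map_zsmul (hs.chi X), smul_assoc, smul_mul_assoc, ← smul_sub,
        mul_smul_comm]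
  obtain ⟨m, hm⟩ := h _ (fun b => F (of ℤ M b)) (by
    intro a b
    have hmem : (eY * of ℤ M a - ind (fun m => Y ≤ s m) a • eY) *
        (of ℤ M b * eX - ind (fun m => X ≤ s m) b • eX) ∈ hs.rad * hs.rad := by
      refine Submodule.mul_mem_mul (fun ω => ?_) (fun ω => ?_)
      · rw [map_sub, map_mul, map_zsmul, hs.chi_of, smul_eq_mul]
        by_cases hω : ω = Y
        · rw [hω, mul_comm, sub_self]
        · rw [heY ω hω, zero_mul, mul_zero, sub_zero]
      · rw [map_sub, map_mul, map_zsmul, hs.chi_of, smul_eq_mul]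
        by_cases hω : ω = X
        · rw [hω, sub_self]
        · rw [heX ω hω, mul_zero, mul_zero, sub_zero]
    rw [← Submodule.ker_mkQ (hs.rad * hs.rad), LinearMap.mem_ker] at hmem
    rw [← sub_eq_zero, ← hmem]
    change F _ - (_ • F _ + _ • F _) = Q _
    rw [hF, hF, hF, hs.chi_of, hs.chi_of, ← map_smul, ← map_smul, ← map_add, ← map_sub,
      ← hs.chi_of X (a * b), map_mul, map_mul, hs.chi_of, hs.chi_of]
    congr 1
    simp only [mul_sub, sub_mul, mul_smul_comm, smul_mul_assoc, smul_sub, mul_smul, mul_assoc]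
    module)
  have hsum : ∀ x, ∃ c : ι → ℤ, F x =
      ∑ i, c i • Q (eY * (of ℤ M (p i) - of ℤ M (q i)) * eX) + (hs.chi X x - hs.chi Y x) • m := by
    intro x
    induction x using MonoidAlgebra.induction_on with
    | of a =>
      refine ⟨fun i => d i a, ?_⟩
      rw [hm a, hs.chi_of, hs.chi_of]
      congr 1
      refine Finset.sum_congr rfl fun i _ => ?_
      rw [← map_sub, hF, map_sub, hs.chi_of, hs.chi_of, hpq, sub_self, zero_smul, sub_zero,
        mul_assoc]
    | add x y hx hy =>
      obtain ⟨c, hc⟩ := hx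
      obtain ⟨c', hc'⟩ := hy
      refine ⟨fun i => c i + c' i, ?_⟩
      simp only [map_add, hc, hc', add_smul, Finset.sum_add_distrib]
      module
    | smul c x hx =>
      obtain ⟨c', hc⟩ := hx
      refine ⟨fun i => c * c' i, ?_⟩
      rw [map_smul, hc, map_zsmul, map_zsmul]
      simp only [mul_smul, smul_add, Finset.smul_sum, smul_eq_mul, ← mul_sub]
  obtain ⟨c, hc⟩ := hsum x
  rw [hF, hx, hx, sub_self, zero_smul, zero_smul, sub_zero, add_zero, ← mul_assoc] at hc
  simp only [← map_smul, ← map_sum] at hc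
  have hmem : eY * x * eX - ∑ i, c i • (eY * (of ℤ M (p i) - of ℤ M (q i)) * eX) ∈
      hs.rad * hs.rad := by
    rw [← Submodule.ker_mkQ (hs.rad * hs.rad), LinearMap.mem_ker, map_sub, sub_eq_zero]
    exact hc
  rw [← add_sub_cancel (∑ i, c i • (eY * (of ℤ M (p i) - of ℤ M (q i)) * eX)) (eY * x * eX)]
  exact Submodule.add_mem_sup (Submodule.sum_mem _ fun i _ =>
    Submodule.smul_mem _ _ (Submodule.subset_span ⟨i, rfl⟩)) hmem

end IsSupportMap

/-! ### A quiver presentation of the algebra of a monoid -/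

namespace IsSupportMap

variable {M : Type u} {Ω : Type v} [Monoid M] [PartialOrder Ω] {s : M → Ω} (hs : IsSupportMap s)

open MonoidAlgebra

/-- A multiplicatively closed subgroup of the radical that generates it modulo its square is the whole
radical. -/
theorem rad_le_of_le_sup_mul [Finite Ω] {P : Submodule ℤ (MonoidAlgebra ℤ M)} (hP : P ≤ hs.rad)
    (hPP : P * P ≤ P) (h : hs.rad ≤ P ⊔ hs.rad * hs.rad) : hs.rad ≤ P := by
  have key : ∀ n, hs.rad ≤ P ⊔ hs.rad ^ (n + 1) := by
    intro n
    induction n with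
    | zero => rw [pow_one]; exact le_sup_right
    | succ n ih =>
      refine h.trans (sup_le le_sup_left ((mul_le_mul' ih ih).trans ?_))
      rw [Submodule.mul_sup, Submodule.sup_mul, Submodule.sup_mul]
      have hle : hs.rad ^ (n + 1) ≤ hs.rad := by
        rw [pow_succ, Submodule.mul_le]
        exact fun x _ y hy => hs.mul_mem_rad_left x hy
      refine sup_le (sup_le (hPP.trans le_sup_left) ?_) (sup_le ?_ ?_)
      · rw [pow_succ _ (n + 1)]
        exact (mul_le_mul' le_rfl hP).trans le_sup_right
      · rw [pow_succ' _ (n + 1)]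
        exact (mul_le_mul' hP le_rfl).trans le_sup_right
      · rw [pow_succ _ (n + 1)]
        exact (mul_le_mul' le_rfl hle).trans le_sup_right
  obtain ⟨n, hn, h0⟩ := hs.exists_rad_pow_eq_bot
  obtain ⟨m, rfl⟩ : ∃ m, n = m + 1 := ⟨n - 1, by omega⟩
  have := key m
  rwa [h0, sup_bot_eq] at this

open Classical in
theorem coeff_eq_zero_of_linearCombination {α E : Type*} [AddCommGroup E] {g : α → E}
    (F : E →ₗ[ℤ] ℤ) (y : α →₀ ℤ) (h : F (Finsupp.linearCombination ℤ g y) = 0) (a₀ : α)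
    (hF : ∀ a, y a ≠ 0 → F (g a) = if a = a₀ then 1 else 0) : y a₀ = 0 := by
  rw [Finsupp.linearCombination_apply, map_finsuppSum, Finsupp.sum_eq_single a₀] at h
  · by_contra hne
    rw [map_smul, hF a₀ hne, if_pos rfl, smul_eq_mul, mul_one] at h
    exact hne h
  · intro a ha hne
    rw [map_smul, hF a ha, if_neg hne, smul_zero]
  · intro _
    rw [zero_smul, map_zero]

variable {V : Type w} [Quiver.{0} V] [∀ X Y : V, Fintype (X ⟶ Y)]

open Classical in
/-- Suppose that the derivations for the pairs of elements of `V ⊆ Ω` are free on the arrows of a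
quiver on `V`, and are inner for the other pairs of elements of `Ω`. Then the quiver has a
representation in the monoid algebra whose values on paths span the common kernel of the characters
outside of `V`, with nilpotent arrows and without relations in degrees `0` and `1`. -/
theorem exists_quiverRep [Fintype Ω] {j : V → Ω} (hj : Function.Injective j)
    (hb : ∀ X Y : V, HasDerivationBasis (X ⟶ Y) (ind fun m => j Y ≤ s m) (ind fun m => j X ≤ s m))
    (hb' : ∀ ω ω' : Ω, ω ∉ Set.range j ∨ ω' ∉ Set.range j →
      HasDerivationBasis Empty (ind fun m => ω' ≤ s m) (ind fun m => ω ≤ s m)) :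
    ∃ ρ : QuiverRep V (MonoidAlgebra ℤ M),
      (∀ p : QPath V, ∀ ω ∉ Set.range j, hs.chi ω (ρ.eval p) = 0) ∧
      (∀ x, (∀ ω ∉ Set.range j, hs.chi ω x = 0) → x ∈ Submodule.span ℤ (Set.range ρ.eval)) ∧
      (∃ n, 2 ≤ n ∧ ∀ p : QPath V, n ≤ p.length → ρ.eval p = 0) ∧
      ∀ x : PathAlgebra ℤ V, ρ.evalLin x = 0 → ∀ p : QPath V, p.length < 2 → x.coeff p = 0 := by
  obtain ⟨e, he, hχe⟩ := hs.exists_idempotents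
  choose! p q d hd hpq hdpq hD using hb
  let β {X Y : V} (a : X ⟶ Y) : MonoidAlgebra ℤ M := of ℤ M (p X Y a) - of ℤ M (q X Y a)
  let ρ : QuiverRep V (MonoidAlgebra ℤ M) :=
    { vert := fun X => e (j X)
      arr := fun {X Y} a => e (j Y) * β a * e (j X)
      vert_mul_self := fun X => he.idem _
      vert_mul_of_ne := fun h => he.ortho (hj.ne h)
      vert_mul_arr := fun a => by rw [← mul_assoc, ← mul_assoc, he.idem]
      arr_mul_vert := fun a => by rw [mul_assoc, he.idem] }
  have hβ : ∀ {X Y : V} (a : X ⟶ Y), hs.chi (j Y) (β a) = 0 ∧ hs.chi (j X) (β a) = 0 := by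
    intro X Y a
    rw [map_sub, map_sub, hs.chi_of, hs.chi_of, hs.chi_of, hs.chi_of, (hpq X Y a).1, (hpq X Y a).2,
      sub_self, sub_self]
    exact ⟨rfl, rfl⟩
  have harr : ∀ {X Y : V} (a : X ⟶ Y), ρ.arr a ∈ hs.rad := by
    intro X Y a ω
    change hs.chi ω (e (j Y) * β a * e (j X)) = 0
    rw [map_mul, map_mul]
    by_cases h : ω = j Y
    · rw [h, (hβ a).1, mul_zero, zero_mul]
    · rw [hχe, if_neg h, zero_mul, zero_mul]
  have hpos : ∀ p : QPath V, 0 < p.length → ρ.eval p ∈ hs.rad := by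
    intro p hp
    have h := ρ.eval_mem_pow harr p hp
    obtain ⟨n, hn⟩ : ∃ n, p.length = n + 1 := ⟨_, (Nat.succ_pred_eq_of_pos hp).symm⟩
    rw [hn, pow_succ] at h
    refine (Submodule.mul_le.2 fun x _ y hy => hs.mul_mem_rad_left x hy) h
  have hnil : ∀ X, ρ.eval (QPath.nil X) = e (j X) := fun X => rfl
  have hsingle : ∀ {X Y : V} (a : X ⟶ Y), ρ.eval ⟨X, Y, a.toPath⟩ = ρ.arr a :=
    fun a => ρ.arr_mul_vert a
  refine ⟨ρ, ?_, ?_, ?_, ?_⟩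
  · rintro ⟨X, Y, p⟩ ω hω
    rw [QuiverRep.eval, ← ρ.vert_mul_evalPath, map_mul]
    change hs.chi ω (e (j Y)) * _ = 0
    rw [hχe, if_neg (fun h => hω ⟨Y, h.symm⟩), zero_mul]
  · let P : Submodule ℤ (MonoidAlgebra ℤ M) :=
      Submodule.span ℤ (ρ.eval '' {p : QPath V | 0 < p.length})
    have hP : P ≤ hs.rad := by
      rw [Submodule.span_le]
      rintro _ ⟨p, hp, rfl⟩
      exact hpos p hp
    have hPP : P * P ≤ P := by
      rw [Submodule.span_mul_span, Submodule.span_le]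
      rintro _ ⟨_, ⟨p, hp, rfl⟩, _, ⟨q, hq, rfl⟩, rfl⟩
      change ρ.eval p * ρ.eval q ∈ P
      by_cases h : q.tgt = p.src
      · rw [← ρ.eval_comp p q h]
        refine Submodule.subset_span ⟨_, ?_, rfl⟩
        change 0 < (p.comp q h).length
        rw [QPath.length_comp]
        exact Nat.add_pos_left hq _
      · rw [ρ.eval_mul_of_ne h]
        exact Submodule.zero_mem _
    have hsup : hs.rad ≤ P ⊔ hs.rad * hs.rad := by
      intro x hx
      have hsum : x = ∑ ω', ∑ ω, e ω' * x * e ω := by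
        simp_rw [← Finset.mul_sum, he.complete, mul_one, ← Finset.sum_mul, he.complete, one_mul]
      rw [hsum]
      refine Submodule.sum_mem _ fun ω' _ => Submodule.sum_mem _ fun ω _ => ?_
      have hχ : ∀ ω ω', ω' ≠ ω → hs.chi ω' (e ω) = 0 := fun ω ω' h => by rw [hχe, if_neg h]
      by_cases h : ω ∈ Set.range j ∧ ω' ∈ Set.range j
      · obtain ⟨⟨X, rfl⟩, ⟨Y, rfl⟩⟩ := h
        have hle := hs.mul_mul_mem_span_sup (hχ (j Y)) (hχ (j X))
          (fun i => (hpq X Y i).2) (hD X Y) hx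
        refine (sup_le_sup_right (Submodule.span_le.2 ?_) _ : _ ≤ P ⊔ _) hle
        rintro _ ⟨a, rfl⟩
        refine Submodule.subset_span ⟨⟨X, Y, a.toPath⟩, ?_, hsingle a⟩
        exact Nat.one_pos
      · obtain ⟨p, q, d, -, hpq, -, hD⟩ := hb' ω ω' (not_and_or.1 h)
        have hle := hs.mul_mul_mem_span_sup (hχ ω') (hχ ω) (fun i => (hpq i).2) hD hx
        refine (sup_le_sup_right (Submodule.span_le.2 ?_) _ : _ ≤ P ⊔ _) hle
        rintro _ ⟨a, rfl⟩
        exact a.elim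
    have hrad := hs.rad_le_of_le_sup_mul hP hPP hsup
    intro x hx
    have hmem : x - ∑ ω, hs.chi ω x • e ω ∈ hs.rad := by
      intro ω
      rw [map_sub, map_sum]
      simp only [map_zsmul, hχe, smul_eq_mul, mul_ite, mul_one, mul_zero]
      rw [Finset.sum_ite_eq, if_pos (Finset.mem_univ _), sub_self]
    rw [← sub_add_cancel x (∑ ω, hs.chi ω x • e ω)]
    refine Submodule.add_mem _ (Submodule.span_mono (Set.image_subset_range _ _) (hrad hmem))
      (Submodule.sum_mem _ fun ω _ => ?_)
    by_cases hω : ω ∈ Set.range j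
    · obtain ⟨X, rfl⟩ := hω
      exact Submodule.smul_mem _ _ (Submodule.subset_span ⟨QPath.nil X, hnil X⟩)
    · rw [hx ω hω, zero_smul]
      exact Submodule.zero_mem _
  · obtain ⟨n, hn, h0⟩ := hs.exists_rad_pow_eq_bot
    refine ⟨n, hn, fun p hp => ?_⟩
    have h := ρ.eval_mem_pow harr p (by omega)
    obtain ⟨m, hm⟩ := Nat.exists_eq_add_of_le hp
    rw [hm, pow_add, h0, Submodule.bot_mul, Submodule.mem_bot] at h
    exact h
  · intro x hx
    -- coefficients are detected by functionals that are dual to a path: the characters for the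
    -- empty paths, and then the derivations `d` for the arrows
    have hlin : ∀ (F : MonoidAlgebra ℤ M →ₗ[ℤ] ℤ) (p₀ : QPath V),
        (∀ p, x.coeff p ≠ 0 → F (ρ.eval p) = if p = p₀ then 1 else 0) → x.coeff p₀ = 0 :=
      fun F p₀ => coeff_eq_zero_of_linearCombination F _ ((congrArg F hx).trans (map_zero F)) p₀
    have h0 : ∀ X, x.coeff (QPath.nil X) = 0 := by
      intro Y
      refine hlin (hs.chi (j Y)).toAddMonoidHom.toIntLinearMap _ ?_
      rintro ⟨X, Z, p⟩ -
      change hs.chi (j Y) (ρ.eval _) = _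
      cases p with
      | nil =>
        refine (hχe _ _).trans ?_
        by_cases h : Y = X
        · subst h
          rw [if_pos rfl]
          exact (if_pos rfl).symm
        · rw [if_neg (hj.ne h), if_neg fun h' => h (congrArg QPath.src h').symm]
      | cons p a =>
        rw [if_neg, hpos ⟨X, Z, p.cons a⟩ (Nat.succ_pos _)]
        intro h
        exact absurd (congrArg QPath.length h) (Nat.succ_ne_zero _)
    rintro ⟨X, Y, p⟩ hp
    cases p with
    | nil => exact h0 X
    | cons p a =>
      cases p with
      | cons p b => exact absurd hp (by simp [QPath.length])
      | nil =>
        refine hlin (linExt (d X Y a)) _ ?_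
        have hne2 : ∀ r : QPath V, 2 ≤ r.length → r ≠ ⟨X, Y, a.toPath⟩ := by
          rintro r hr rfl
          exact absurd hr (by simp [QPath.length, Quiver.Hom.toPath])
        rintro ⟨X', Y', r⟩ hr
        cases r with
        | nil => exact absurd (h0 X') hr
        | cons r b =>
          cases r with
          | cons r c =>
            refine Eq.trans ?_ (if_neg (hne2 ⟨X', Y', (r.cons c).cons b⟩ (by
              simp [QPath.length]))).symm
            refine hs.linExt_eq_zero_of_mem (hd X Y a) ?_
            change ρ.arr b * ρ.eval ⟨X', _, r.cons c⟩ ∈ _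
            exact Submodule.mul_mem_mul (harr b) (hpos _ (Nat.succ_pos _))
          | nil =>
            change linExt (d X Y a) (ρ.eval ⟨X', Y', b.toPath⟩) = _
            have hb0 := harr b
            rw [hsingle, ← ρ.vert_mul_arr, hs.linExt_mul (hd X Y a), hb0, zero_smul, add_zero,
              ← ρ.arr_mul_vert, hs.linExt_mul (hd X Y a), hb0, zero_smul, zero_add]
            change hs.chi (j Y) (e (j Y')) • hs.chi (j X) (e (j X')) • _ = _
            by_cases hX : X = X'
            · by_cases hY : Y = Y'
              · subst hX hY
                change _ • _ • linExt (d X Y a) (e (j Y) * β b * e (j X)) = _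
                rw [hχe, hχe, if_pos rfl, if_pos rfl, one_smul, one_smul,
                  hs.linExt_mul (hd X Y a), hs.linExt_mul (hd X Y a), map_mul, (hβ b).1, (hβ b).2,
                  mul_zero, zero_smul, zero_smul, zero_add, add_zero, hχe, hχe, if_pos rfl,
                  if_pos rfl, one_smul, one_smul, map_sub, linExt_of, linExt_of, hdpq]
                by_cases hab : a = b
                · subst hab
                  rw [if_pos rfl]
                  exact (if_pos rfl).symm
                · rw [if_neg hab, if_neg]
                  intro h
                  simp only [QPath.mk.injEq, heq_eq_eq, true_and, Quiver.Path.cons.injEq] at h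
                  exact hab h.symm
              · rw [hχe, if_neg (hj.ne hY), zero_smul, if_neg]
                exact fun h => hY (congrArg QPath.tgt h).symm
            · rw [hχe (j X), if_neg (hj.ne hX), zero_smul, smul_zero, if_neg]
              exact fun h => hX (congrArg QPath.src h).symm

end IsSupportMap

/-! ### Presentations of semigroup algebras by admissible ideals and change of scalars -/

namespace PathAlgebra

variable {k : Type w} [CommRing k] {V : Type u} [Quiver.{v} V] [Fintype V]

theorem arrowIdeal_pow_le_span (n : ℕ) (x : PathAlgebra k V) (hx : x ∈ arrowIdeal k V ^ n) :
    x ∈ Submodule.span k (ofPath '' {p : QPath V | n ≤ p.length}) := by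
  induction n generalizing x with
  | zero =>
    refine (mem_supported_iff _ x).1 fun p _ => Nat.zero_le _
  | succ n ih =>
    rw [Submodule.pow_succ] at hx
    refine Submodule.mul_induction_on hx ?_ fun a b ha hb => Submodule.add_mem _ ha hb
    intro a ha b hb
    replace ha := ih a ha
    replace hb := (mem_supported_iff _ b).1 hb
    change mulHom k V a b ∈ _
    refine Submodule.span_induction (p := fun a _ => mulHom k V a b ∈ _) ?_ ?_ ?_ ?_ ha
    · rintro _ ⟨p, hp, rfl⟩
      refine Submodule.span_induction (p := fun b _ => mulHom k V (ofPath p) b ∈ _) ?_ ?_ ?_ ?_ hb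
      · rintro _ ⟨q, hq, rfl⟩
        rw [mulHom_ofPath]
        by_cases h : q.tgt = p.src
        · rw [pathMul_of_eq h]
          refine Submodule.subset_span ⟨_, ?_, rfl⟩
          change n + 1 ≤ (p.comp q h).length
          have hp' : n ≤ p.length := hp
          have hq' : 0 < q.length := hq
          rw [QPath.length_comp]
          omega
        · rw [pathMul_of_ne h]
          exact Submodule.zero_mem _
      · rw [map_zero]; exact Submodule.zero_mem _
      · intro a b _ _ ha hb
        rw [map_add]; exact Submodule.add_mem _ ha hb
      · intro c a _ ha
        rw [map_smul]; exact Submodule.smul_mem _ _ ha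
    · rw [map_zero, LinearMap.zero_apply]; exact Submodule.zero_mem _
    · intro a b _ _ ha hb
      rw [map_add, LinearMap.add_apply]; exact Submodule.add_mem _ ha hb
    · intro c a _ ha
      rw [map_smul, LinearMap.smul_apply]; exact Submodule.smul_mem _ _ ha

theorem smul_mem_ideal (I : Ideal (PathAlgebra k V)) (c : k) {x : PathAlgebra k V} (hx : x ∈ I) :
    c • x ∈ I := by
  rw [← one_mul x, ← smul_mul_assoc]
  exact I.mul_mem_left _ hx

theorem span_le_ideal {I : Ideal (PathAlgebra k V)} {s : Set (QPath V)}
    (h : ∀ p ∈ s, ofPath p ∈ I) {x : PathAlgebra k V} (hx : x ∈ Submodule.span k (ofPath '' s)) :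
    x ∈ I := by
  refine Submodule.span_induction (p := fun x _ => x ∈ I) ?_ I.zero_mem
    (fun a b _ _ ha hb => I.add_mem ha hb) (fun c a _ ha => smul_mem_ideal I c ha) hx
  rintro _ ⟨p, hp, rfl⟩
  exact h p hp

theorem ofPath_mem_arrowIdeal {p : QPath V} (hp : 0 < p.length) :
    (ofPath p : PathAlgebra k V) ∈ arrowIdeal k V :=
  (mem_supported_iff {p | 0 < p.length} _).2 (Submodule.subset_span ⟨p, hp, rfl⟩)

theorem ofPath_mem_arrowIdeal_sq {p : QPath V} (hp : 2 ≤ p.length) :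
    (ofPath p : PathAlgebra k V) ∈ arrowIdeal k V ^ 2 := by
  obtain ⟨X, Y, p⟩ := p
  cases p with
  | nil => exact absurd hp (by simp [QPath.length])
  | cons p a =>
    have h : (ofPath ⟨X, Y, p.cons a⟩ : PathAlgebra k V) =
        ofPath ⟨_, Y, a.toPath⟩ * ofPath ⟨X, _, p⟩ := by
      rw [ofPath_mul_ofPath, pathMul_of_eq rfl]
      rfl
    rw [h, Submodule.pow_succ, Submodule.pow_one]
    refine Ideal.mul_mem_mul (ofPath_mem_arrowIdeal Nat.one_pos) (ofPath_mem_arrowIdeal ?_)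
    exact Nat.lt_of_succ_le (Nat.le_of_succ_le_succ hp)

theorem IsAdmissible.of_paths {I : Ideal (PathAlgebra k V)} [I.IsTwoSided]
    (hn : ∃ n, 2 ≤ n ∧ ∀ p : QPath V, n ≤ p.length → (ofPath p : PathAlgebra k V) ∈ I)
    (h2 : ∀ x ∈ I, ∀ p : QPath V, p.length < 2 → x.coeff p = 0)
    (hproj : Module.Projective k (PathAlgebra k V ⧸ I)) : IsAdmissible I where
  pow_le := by
    obtain ⟨n, hn, h⟩ := hn
    exact ⟨n, hn, fun x hx => span_le_ideal h (arrowIdeal_pow_le_span n x hx)⟩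
  le_sq x hx := by
    refine span_le_ideal (s := {p | 2 ≤ p.length}) (fun p hp => ofPath_mem_arrowIdeal_sq hp) ?_
    refine (mem_supported_iff _ x).1 fun p hp => ?_
    by_contra h
    exact hp (h2 x hx p (not_le.1 h))
  projective := hproj

end PathAlgebra

namespace QuiverRep

open PathAlgebra

section Algebra

variable {V : Type u} [Quiver.{v} V] [Fintype V] {k : Type w} {S : Type*} [CommRing k] [Semigroup S]
  (ρ : QuiverRep V (MonoidAlgebra k S))

theorem evalLin_mul (x y : PathAlgebra k V) : ρ.evalLin (x * y) = ρ.evalLin x * ρ.evalLin y := by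
  induction x using PathAlgebra.induction_on with
  | h0 => rw [zero_mul, map_zero, zero_mul]
  | h1 c p =>
    induction y using PathAlgebra.induction_on with
    | h0 => rw [mul_zero, map_zero, mul_zero]
    | h1 d q =>
      rw [smul_mul_smul_comm, map_smul, map_smul, map_smul, smul_mul_smul_comm, evalLin_ofPath,
        evalLin_ofPath, ofPath_mul_ofPath]
      by_cases h : q.tgt = p.src
      · rw [pathMul_of_eq h, evalLin_ofPath, eval_comp]
      · rw [pathMul_of_ne h, map_zero, ρ.eval_mul_of_ne h]
    | h2 a b ha hb => rw [mul_add, map_add, map_add, mul_add, ha, hb]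
  | h2 a b ha hb => rw [add_mul, map_add, map_add, add_mul, ha, hb]

/-- The algebra is isomorphic to the quotient of the path algebra by the kernel of `evalLin`. The
isomorphism is constructed in the direction from the semigroup algebra, which has no identity a
priori. -/
theorem exists_quotient_equiv (hρ : Function.Surjective ρ.evalLin) (I : Ideal (PathAlgebra k V))
    [I.IsTwoSided] (hI : ∀ x, x ∈ I ↔ ρ.evalLin x = 0) :
    ∃ φ : MonoidAlgebra k S →ₙₐ[k] (PathAlgebra k V ⧸ I), Function.Bijective φ := by
  obtain ⟨t, ht⟩ := hρ.hasRightInverse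
  have key : ∀ y, Ideal.Quotient.mk I (t (ρ.evalLin y)) = Ideal.Quotient.mk I y := fun y => by
    rw [Ideal.Quotient.mk_eq_mk_iff_sub_mem, hI, map_sub, ht, sub_self]
  refine ⟨{ toFun := fun x => Ideal.Quotient.mk I (t x), map_smul' := ?_, map_zero' := ?_,
            map_add' := ?_, map_mul' := ?_ }, ?_, ?_⟩
  · intro c x
    obtain ⟨y, rfl⟩ := hρ x
    change Ideal.Quotient.mk I (t (c • _)) = c • Ideal.Quotient.mk I (t _)
    rw [← map_smul, key, key]
    rfl
  · rw [← map_zero ρ.evalLin, key, map_zero]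
  · intro x x'
    obtain ⟨y, rfl⟩ := hρ x
    obtain ⟨y', rfl⟩ := hρ x'
    rw [← map_add, key, key, key, map_add]
  · intro x x'
    obtain ⟨y, rfl⟩ := hρ x
    obtain ⟨y', rfl⟩ := hρ x'
    change Ideal.Quotient.mk I (t _) = Ideal.Quotient.mk I (t _) * Ideal.Quotient.mk I (t _)
    rw [← ρ.evalLin_mul, key, key, key, map_mul]
  · intro x x' h
    have h' : Ideal.Quotient.mk I (t x) = Ideal.Quotient.mk I (t x') := h
    rw [Ideal.Quotient.mk_eq_mk_iff_sub_mem, hI, map_sub, ht, ht, sub_eq_zero] at h'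
    exact h'
  · intro z
    obtain ⟨y, rfl⟩ := Ideal.Quotient.mk_surjective z
    exact ⟨ρ.evalLin y, key y⟩

theorem isAdmissible (hρ : Function.Surjective ρ.evalLin) (I : Ideal (PathAlgebra k V))
    [I.IsTwoSided] (hI : ∀ x, x ∈ I ↔ ρ.evalLin x = 0)
    (hn : ∃ n, 2 ≤ n ∧ ∀ p : QPath V, n ≤ p.length → ρ.eval p = 0)
    (h2 : ∀ x ∈ I, ∀ p : QPath V, p.length < 2 → x.coeff p = 0) : IsAdmissible I := by
  obtain ⟨n, hn, h⟩ := hn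
  refine IsAdmissible.of_paths ⟨n, hn, fun p hp => ?_⟩ h2 ?_
  · rw [hI, evalLin_ofPath, h p hp]
  · obtain ⟨φ, hφ⟩ := ρ.exists_quotient_equiv hρ I hI
    let φ' : MonoidAlgebra k S →ₗ[k] (PathAlgebra k V ⧸ I) :=
      { toFun := φ, map_add' := map_add φ, map_smul' := map_smul φ }
    exact Module.Projective.of_equiv (LinearEquiv.ofBijective φ' hφ)

end Algebra

section BaseChange

/-- The image of a representation under a homomorphism of algebras. -/
def map {V : Type u} [Quiver.{v} V] {A A' : Type*} [NonUnitalRing A] [NonUnitalRing A']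
    (ρ : QuiverRep V A) (θ : A →ₙ+* A') : QuiverRep V A' where
  vert X := θ (ρ.vert X)
  arr a := θ (ρ.arr a)
  vert_mul_self X := by rw [← map_mul, ρ.vert_mul_self]
  vert_mul_of_ne h := by rw [← map_mul, ρ.vert_mul_of_ne h, map_zero]
  vert_mul_arr a := by rw [← map_mul, ρ.vert_mul_arr]
  arr_mul_vert a := by rw [← map_mul, ρ.arr_mul_vert]

theorem eval_map {V : Type u} [Quiver.{v} V] {A A' : Type*} [NonUnitalRing A] [NonUnitalRing A']
    (ρ : QuiverRep V A) (θ : A →ₙ+* A') (p : QPath V) : (ρ.map θ).eval p = θ (ρ.eval p) := by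
  obtain ⟨X, Y, p⟩ := p
  change (ρ.map θ).evalPath p = θ (ρ.evalPath p)
  induction p with
  | nil => rfl
  | cons p a ih => rw [evalPath, evalPath, ih, map_mul]; rfl

/-- The canonical homomorphism from the integral semigroup algebra to the one over `k`. -/
def scalarHom (k S : Type*) [CommRing k] [Semigroup S] :
    MonoidAlgebra ℤ S →ₙ+* MonoidAlgebra k S :=
  (MonoidAlgebra.liftMagma ℤ (MonoidAlgebra.ofMagma k S) :
    MonoidAlgebra ℤ S →ₙₐ[ℤ] MonoidAlgebra k S)

theorem scalarHom_single (k : Type*) {S : Type*} [CommRing k] [Semigroup S] (b : S) :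
    scalarHom k S (MonoidAlgebra.single b 1) = MonoidAlgebra.single b 1 := by
  change MonoidAlgebra.liftMagma ℤ (MonoidAlgebra.ofMagma k S) (MonoidAlgebra.single b 1) = _
  simp [MonoidAlgebra.liftMagma]

variable {V : Type u} [Quiver.{v} V] [Fintype V] {S : Type*} [Semigroup S]
  (ρ : QuiverRep V (MonoidAlgebra ℤ S)) (k : Type w) [CommRing k]

theorem evalLin_mapHom (x : PathAlgebra ℤ V) :
    (ρ.map (scalarHom k S)).evalLin (mapHom V (Int.castRingHom k) x) =
      scalarHom k S (ρ.evalLin x) := by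
  induction x using PathAlgebra.induction_on with
  | h0 => simp only [map_zero]
  | h1 c p =>
    rw [mapHom_smul, mapHom_ofPath, map_smul, map_smul, evalLin_ofPath, evalLin_ofPath, eval_map,
      eq_intCast, Int.cast_smul_eq_zsmul]
    exact (map_zsmul (scalarHom k S) c _).symm
  | h2 a b ha hb => simp only [map_add, ha, hb]

theorem surjective_evalLin_map (hρ : Function.Surjective ρ.evalLin) :
    Function.Surjective (ρ.map (scalarHom k S)).evalLin := by
  rw [← LinearMap.range_eq_top, eq_top_iff]
  rintro x -
  induction x using MonoidAlgebra.induction_linear with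
  | zero => exact Submodule.zero_mem _
  | add x y hx hy => exact Submodule.add_mem _ hx hy
  | single b c =>
    obtain ⟨y, hy⟩ := hρ (MonoidAlgebra.single b 1)
    have : MonoidAlgebra.single b c = c • MonoidAlgebra.single b (1 : k) := by
      rw [MonoidAlgebra.smul_single, smul_eq_mul, mul_one]
    rw [this, ← scalarHom_single, ← hy, ← evalLin_mapHom]
    exact Submodule.smul_mem _ _ ⟨_, rfl⟩

/-- The kernel `I` of a surjection `evalLin` onto a free abelian group is a direct summand, so `k ⊗ I`
embeds, and its image is the kernel of the base change of `evalLin`. -/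
theorem tensorMap_injective_and_mem_tensorIdeal_iff (hρ : Function.Surjective ρ.evalLin)
    (I : Ideal (PathAlgebra ℤ V)) [I.IsTwoSided] (hI : ∀ x, x ∈ I ↔ ρ.evalLin x = 0) :
    Function.Injective (tensorMap k I) ∧
      ∀ x, x ∈ tensorIdeal k I ↔ (ρ.map (scalarHom k S)).evalLin x = 0 := by
  obtain ⟨t, ht⟩ := Module.projective_lifting_property ρ.evalLin LinearMap.id hρ
  have ht' : ∀ y, ρ.evalLin (t y) = y := fun y => LinearMap.congr_fun ht y
  -- the retraction onto `I` given by the section `t`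
  let r : PathAlgebra ℤ V →+ I :=
    { toFun := fun x => ⟨x - t (ρ.evalLin x), by rw [hI, map_sub, ht', sub_self]⟩
      map_zero' := Subtype.ext (by simp only [map_zero, sub_zero, Submodule.coe_zero])
      map_add' := fun x y => Subtype.ext (by
        simp only [map_add, Submodule.coe_add]; abel) }
  have hr : ∀ x : I, r x = x := fun x => Subtype.ext (by
    change x.1 - t (ρ.evalLin x.1) = x.1
    rw [(hI _).1 x.2, map_zero, sub_zero])
  -- its base change, a left inverse of `tensorMap k I`
  let g : PathAlgebra k V →ₗ[k] k ⊗[ℤ] I :=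
    Finsupp.linearCombination k fun p : QPath V => (1 : k) ⊗ₜ[ℤ] r (ofPath p)
  have hgp : ∀ p, g (ofPath p) = (1 : k) ⊗ₜ[ℤ] r (ofPath p) := fun p =>
    (Finsupp.linearCombination_single k 1 p).trans (one_smul k _)
  have hg : ∀ x, g (mapHom V (Int.castRingHom k) x) = (1 : k) ⊗ₜ[ℤ] r x := by
    intro x
    induction x using PathAlgebra.induction_on with
    | h0 => simp only [map_zero, TensorProduct.tmul_zero]
    | h1 c p =>
      refine Eq.trans ?_ (congrArg (fun z => (1 : k) ⊗ₜ[ℤ] z) (map_zsmul r c (ofPath p))).symm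
      rw [mapHom_smul, mapHom_ofPath, map_smul, hgp, TensorProduct.tmul_smul,
        eq_intCast, Int.cast_smul_eq_zsmul]
    | h2 a b ha hb => simp only [map_add, ha, hb, TensorProduct.tmul_add]
  have hgt : ∀ z, g (tensorMap k I z) = z := by
    intro z
    induction z using TensorProduct.induction_on with
    | zero => simp only [map_zero]
    | add y z hy hz => rw [map_add, map_add, hy, hz]
    | tmul c x =>
      rw [tensorMap_tmul, map_smul, hg, hr, TensorProduct.smul_tmul', smul_eq_mul, mul_one]
  refine ⟨Function.LeftInverse.injective hgt, fun x => ⟨?_, fun hx => ?_⟩⟩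
  · rintro ⟨z, rfl⟩
    induction z using TensorProduct.induction_on with
    | zero => simp only [map_zero]
    | add y z hy hz => rw [map_add, map_add, hy, hz, add_zero]
    | tmul c x =>
      rw [tensorMap_tmul, map_smul, evalLin_mapHom, (hI _).1 x.2, map_zero, smul_zero]
  · -- the base change of `t`
    let t' : MonoidAlgebra k S →ₗ[k] PathAlgebra k V :=
      Finsupp.linearCombination k (fun b : S =>
        mapHom V (Int.castRingHom k) (t (MonoidAlgebra.single b 1))) ∘ₗ
          (MonoidAlgebra.coeffLinearEquiv k).toLinearMap
    have ht's : ∀ b, t' (MonoidAlgebra.single b 1) =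
        mapHom V (Int.castRingHom k) (t (MonoidAlgebra.single b 1)) := fun b =>
      (Finsupp.linearCombination_single k 1 b).trans (one_smul k _)
    have ht'θ : ∀ y, t' (scalarHom k S y) = mapHom V (Int.castRingHom k) (t y) := by
      intro y
      induction y using MonoidAlgebra.induction_linear with
      | zero => simp only [map_zero]
      | add x y hx hy => simp only [map_add, hx, hy]
      | single b c =>
        have : MonoidAlgebra.single b c = c • MonoidAlgebra.single b (1 : ℤ) := by
          rw [MonoidAlgebra.smul_single, smul_eq_mul, mul_one]
        rw [this]
        have h1 : scalarHom k S (c • MonoidAlgebra.single b (1 : ℤ)) =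
            c • MonoidAlgebra.single b (1 : k) :=
          (map_zsmul (scalarHom k S) c _).trans (congrArg (c • ·) (scalarHom_single k b))
        rw [h1, map_smul t, mapHom_smul, ← ht's, map_zsmul, eq_intCast, Int.cast_smul_eq_zsmul]
    have key : ∀ x, x = tensorMap k I (g x) + t' ((ρ.map (scalarHom k S)).evalLin x) := by
      intro x
      induction x using PathAlgebra.induction_on with
      | h0 => simp only [map_zero, add_zero]
      | h1 c p =>
        rw [map_smul, map_smul, map_smul, map_smul, ← smul_add, hgp, tensorMap_tmul, one_smul,
          evalLin_ofPath, eval_map, ht'θ, ← map_add]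
        change _ = c • mapHom V _ (ofPath p - t (ρ.evalLin (ofPath p)) + _)
        rw [evalLin_ofPath, sub_add_cancel, mapHom_ofPath]
      | h2 a b ha hb =>
        rw [map_add, map_add, map_add, map_add, add_add_add_comm, ← ha, ← hb]
    rw [key x, hx, map_zero, add_zero]
    exact ⟨_, rfl⟩

end BaseChange

end QuiverRep

/-! ### Bands, their support semilattice, and the derivations of a connected band -/

namespace Band

variable {B : Type u} [Band B]

theorem supp_le_supp_iff {a b : B} : supp a ≤ supp b ↔ ∃ c d, a = c * b * d := by
  constructor
  · intro h
    exact h ⟨a, a, by rw [mul_self, mul_self]⟩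
  · rintro ⟨c, d, rfl⟩ _ ⟨x, y, rfl⟩
    exact ⟨x * c, d * y, by simp only [mul_assoc]⟩

theorem le_supp_mul_iff {X : SupportLattice B} {a b : B} :
    X ≤ supp (a * b) ↔ X ≤ supp a ∧ X ≤ supp b := by
  constructor
  · intro h
    exact ⟨h.trans (supp_le_supp_iff.2 ⟨a, b, by rw [mul_self]⟩),
      h.trans (supp_le_supp_iff.2 ⟨a, b, by rw [mul_assoc, mul_self]⟩)⟩
  · rintro ⟨ha, hb⟩
    obtain ⟨_, z, rfl⟩ := X
    obtain ⟨c, d, h1⟩ := supp_le_supp_iff.1 (show supp z ≤ supp a from ha)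
    obtain ⟨c', d', h2⟩ := supp_le_supp_iff.1 (show supp z ≤ supp b from hb)
    refine supp_le_supp_iff.2 ?_
    have key : ∀ x, ∃ p q, a * x * b = p * (a * b) * q := by
      intro x
      refine ⟨a * x * b, a * x * b, ?_⟩
      calc a * x * b = a * x * b * (a * x * b) := (mul_self _).symm
        _ = a * x * (b * a) * (x * b) := by simp only [mul_assoc]
        _ = a * x * (b * a * (b * a)) * (x * b) := by rw [mul_self (b * a)]
        _ = _ := by simp only [mul_assoc]
    obtain ⟨p, q, hpq⟩ := key (d * c')
    refine ⟨c * p, q * d', ?_⟩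
    calc z = z * z := (mul_self z).symm
      _ = c * a * d * (c' * b * d') := by rw [← h1, ← h2]
      _ = c * (a * (d * c') * b) * d' := by simp only [mul_assoc]
      _ = _ := by rw [hpq]; simp only [mul_assoc]

theorem mul_mul_self_of_supp_le {a b : B} (h : supp a ≤ supp b) : a * b * a = a := by
  obtain ⟨c, d, h⟩ := supp_le_supp_iff.1 h
  have had : a * d = a := by rw [h, mul_assoc, mul_self]
  have hcba : c * (b * a) = a := by
    have hca : c * a = a := by rw [h, ← mul_assoc, ← mul_assoc, mul_self]
    have hcb : c * b * a = a := by
      conv_lhs => rw [h]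
      rw [← mul_assoc, mul_self, ← h]
    rw [← mul_assoc, hcb]
  calc a * b * a = c * (b * a) * (b * a) := by rw [hcba, mul_assoc]
    _ = a := by rw [mul_assoc, mul_self, hcba]

/-- The elements of a fixed support form a rectangular band, on which the elements of larger support
act trivially in the middle of a product. -/
theorem mul_mul_eq_of_supp_le {a b c : B} (h : supp a = supp c) (h' : supp a ≤ supp b) :
    a * b * c = a * c := by
  have hc : c * a * c = c := mul_mul_self_of_supp_le h.ge
  have hbc : a * (b * c) * a = a :=
    mul_mul_self_of_supp_le (le_supp_mul_iff.2 ⟨h', h.le⟩)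
  calc a * b * c = a * b * (c * a * c) := by rw [hc]
    _ = a * (b * c) * a * c := by simp only [mul_assoc]
    _ = a * c := by rw [hbc]

/-- The support map of the band with an identity adjoined, whose support is a new top element. -/
def suppOne (m : WithOne B) : WithTop (SupportLattice B) :=
  WithOne.recOneCoe (motive := fun _ => WithTop (SupportLattice B)) ⊤ (fun b => (supp b : WithTop (SupportLattice B))) m

theorem suppOne_one : suppOne (1 : WithOne B) = ⊤ := rfl

theorem suppOne_coe (b : B) : suppOne (b : WithOne B) = supp b := rfl

theorem coe_le_suppOne {X : SupportLattice B} {b : B} :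
    (X : WithTop (SupportLattice B)) ≤ suppOne (b : WithOne B) ↔ X ≤ supp b :=
  WithTop.coe_le_coe

theorem not_top_le_suppOne (b : B) : ¬ ⊤ ≤ suppOne (b : WithOne B) := by
  rw [suppOne_coe, top_le_iff]
  exact WithTop.coe_ne_top

theorem withOne_mul_self (m : WithOne B) : m * m = m := by
  cases m with
  | one => rfl
  | coe b => rw [← WithOne.coe_mul, mul_self]

theorem isSupportMap : IsSupportMap (suppOne (B := B)) where
  surjective X := by
    cases X with
    | top => exact ⟨1, rfl⟩
    | coe X =>
      obtain ⟨_, b, rfl⟩ := X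
      exact ⟨b, rfl⟩
  le_mul_iff {X a b} := by
    cases a with
    | one => simp [suppOne_one]
    | coe a =>
      cases b with
      | one => simp [suppOne_one]
      | coe b =>
        rw [← WithOne.coe_mul]
        cases X with
        | top => simp only [not_top_le_suppOne, and_self]
        | coe X => rw [coe_le_suppOne, coe_le_suppOne, coe_le_suppOne, le_supp_mul_iff]
  le_one X := le_top
  mul_mul_eq {a b c} h h' := by
    cases a with
    | one =>
      cases c with
      | one =>
        cases b with
        | one => rfl
        | coe b => exact absurd h' (not_top_le_suppOne b)
      | coe c => exact absurd h.le (not_top_le_suppOne c)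
    | coe a =>
      cases c with
      | one => exact absurd h.ge (not_top_le_suppOne a)
      | coe c =>
        cases b with
        | one => rw [mul_one]
        | coe b =>
          rw [suppOne_coe, suppOne_coe, WithTop.coe_inj] at h
          rw [← WithOne.coe_mul, ← WithOne.coe_mul, ← WithOne.coe_mul,
            mul_mul_eq_of_supp_le h (WithTop.coe_le_coe.1 h')]

section Basis

variable [Finite B] {f : SupportLattice B → B}

/-- The derivations for `X < Y` are described by the graph on `L_X`; here `Y` may be the support of
the adjoined identity. -/
theorem hasDerivationBasis_lset (hf : ∀ X, supp (f X) = X) {X : SupportLattice B} {Y : WithTop (SupportLattice B)}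
    (hXY : X < Y) (r : LSet f X → LSet f X → Prop)
    (hrel : ∀ s t, s ≠ t → (r s t ↔ (∃ b : B, Y ≤ supp b ∧ t.1 = b * s.1) ∨
      ∃ b : B, LeR s.1 b ∧ LeR t.1 b ∧ ¬ Y ≤ supp b))
    (ι : Type) [Fintype ι]
    (hι : Nat.card ι = Nat.card (SimpleGraph.fromRel r).ConnectedComponent - 1) :
    HasDerivationBasis ι (ind fun m : WithOne B => Y ≤ suppOne m)
      (ind fun m => X ≤ suppOne m) := by
  have hsupp : ∀ t : LSet f X, suppOne (t.1 : WithOne B) = X := fun t => by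
    rw [suppOne_coe, t.2.1]
  have hfX : suppOne (f X : WithOne B) = X := by rw [suppOne_coe, hf]
  refine hasDerivationBasis_fromRel (v := fun t : LSet f X => (t.1 : WithOne B))
    (f := (f X : WithOne B)) withOne_mul_self
    (fun a b => isSupportMap.le_mul_iff) (fun a b => isSupportMap.le_mul_iff)
    (fun a h => hXY.le.trans h) (fun s t h => Subtype.ext (WithOne.coe_inj.1 h))
    (fun t => (hsupp t).ge) (fun t h => hXY.not_ge (h.trans (hsupp t).le)) hfX.ge
    (fun h => hXY.not_ge (h.trans hfX.le)) ?_ ?_ r ?_ ι hι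
  · rintro ⟨_, h, c, rfl⟩
    change ((c * f X : B) : WithOne B) * f X = (c * f X : B)
    rw [← WithOne.coe_mul, mul_assoc, mul_self]
  · intro b hb
    cases b with
    | one => exact ⟨⟨f X, hf X, f X, (mul_self _).symm⟩, (one_mul _).symm⟩
    | coe b =>
      refine ⟨⟨b * f X, le_antisymm ?_ ?_, b, rfl⟩, WithOne.coe_mul _ _⟩
      · exact (le_supp_mul_iff.1 le_rfl).2.trans (hf X).le
      · exact le_supp_mul_iff.2 ⟨coe_le_suppOne.1 hb, (hf X).ge⟩
  · intro s t hne
    rw [hrel s t hne]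
    constructor
    · rintro (⟨b, hb, h⟩ | ⟨b, h, h', hb⟩)
      · exact Or.inl ⟨b, hb, by rw [h, WithOne.coe_mul]⟩
      · exact Or.inr ⟨b, by rw [← WithOne.coe_mul, h], by rw [← WithOne.coe_mul, h'], hb⟩
    · rintro (⟨b, hb, h⟩ | ⟨b, h, h', hb⟩)
      · cases b with
        | one =>
          rw [one_mul] at h
          exact absurd (Subtype.ext (WithOne.coe_inj.1 h)).symm hne
        | coe b => exact Or.inl ⟨b, hb, WithOne.coe_inj.1 h⟩
      · cases b with
        | one => exact absurd le_top hb
        | coe b => exact Or.inr ⟨b, WithOne.coe_inj.1 h, WithOne.coe_inj.1 h', hb⟩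

/-- The derivations for `Y < X` are described by the graph on `R_Y`; here `X` may be the support of
the adjoined identity. -/
theorem hasDerivationBasis_rset (hf : ∀ X, supp (f X) = X) {Y : SupportLattice B} {X : WithTop (SupportLattice B)}
    (hYX : Y < X) (r : RSet f Y → RSet f Y → Prop)
    (hrel : ∀ s t, s ≠ t → (r s t ↔ (∃ b : B, X ≤ supp b ∧ t.1 = s.1 * b) ∨
      ∃ b : B, LeL s.1 b ∧ LeL t.1 b ∧ ¬ X ≤ supp b))
    (ι : Type) [Fintype ι]
    (hι : Nat.card ι = Nat.card (SimpleGraph.fromRel r).ConnectedComponent - 1) :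
    HasDerivationBasis ι (ind fun m : WithOne B => Y ≤ suppOne m)
      (ind fun m => X ≤ suppOne m) := by
  have hsupp : ∀ t : RSet f Y, suppOne (t.1 : WithOne B) = Y := fun t => by
    rw [suppOne_coe, t.2.1]
  have hfY : suppOne (f Y : WithOne B) = Y := by rw [suppOne_coe, hf]
  refine HasDerivationBasis.of_op (hasDerivationBasis_fromRel
    (U := fun m : (WithOne B)ᵐᵒᵖ => Y ≤ suppOne m.unop)
    (V := fun m : (WithOne B)ᵐᵒᵖ => X ≤ suppOne m.unop)
    (v := fun t : RSet f Y => MulOpposite.op (t.1 : WithOne B))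
    (f := .op (f Y : WithOne B)) (fun a => MulOpposite.unop_injective (withOne_mul_self _))
    (fun a b => isSupportMap.le_mul_iff.trans and_comm)
    (fun a b => isSupportMap.le_mul_iff.trans and_comm)
    (fun a h => hYX.le.trans h)
    (fun s t h => Subtype.ext (WithOne.coe_inj.1 (MulOpposite.op_injective h)))
    (fun t => (hsupp t).ge) (fun t h => hYX.not_ge (h.trans (hsupp t).le)) hfY.ge
    (fun h => hYX.not_ge (h.trans hfY.le)) ?_ ?_ r ?_ ι hι)
  · rintro ⟨_, h, c, rfl⟩
    refine MulOpposite.unop_injective ?_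
    change (f Y : WithOne B) * ((f Y * c : B) : WithOne B) = (f Y * c : B)
    rw [← WithOne.coe_mul, ← mul_assoc, mul_self]
  · intro b hb
    induction b using MulOpposite.rec' with | _ b
    cases b with
    | one => exact ⟨⟨f Y, hf Y, f Y, (mul_self _).symm⟩, (one_mul _).symm⟩
    | coe b =>
      refine ⟨⟨f Y * b, le_antisymm ?_ ?_, b, rfl⟩, congrArg MulOpposite.op (WithOne.coe_mul _ _)⟩
      · exact (le_supp_mul_iff.1 le_rfl).1.trans (hf Y).le
      · exact le_supp_mul_iff.2 ⟨(hf Y).ge, coe_le_suppOne.1 hb⟩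
  · intro s t hne
    rw [hrel s t hne]
    constructor
    · rintro (⟨b, hb, h⟩ | ⟨b, h, h', hb⟩)
      · exact Or.inl ⟨.op b, hb, by rw [h, WithOne.coe_mul, MulOpposite.op_mul]⟩
      · exact Or.inr ⟨.op b, by rw [← MulOpposite.op_mul, ← WithOne.coe_mul, h],
          by rw [← MulOpposite.op_mul, ← WithOne.coe_mul, h'], hb⟩
    · rintro (⟨b, hb, h⟩ | ⟨b, h, h', hb⟩)
      · induction b using MulOpposite.rec' with | _ b
        replace h := MulOpposite.op_injective h
        cases b with
        | one => exact absurd (Subtype.ext (WithOne.coe_inj.1 (h.trans (mul_one _)))).symm hne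
        | coe b => exact Or.inl ⟨b, hb, WithOne.coe_inj.1 h⟩
      · induction b using MulOpposite.rec' with | _ b
        replace h := MulOpposite.op_injective h
        replace h' := MulOpposite.op_injective h'
        cases b with
        | one => exact absurd le_top hb
        | coe b => exact Or.inr ⟨b, WithOne.coe_inj.1 h, WithOne.coe_inj.1 h', hb⟩

theorem card_connectedComponent_sub_one {F T : Type*} [Nonempty T] {G : SimpleGraph F}
    (hG : G.Connected) {G' : SimpleGraph T} {π : F → T} (hπ : Function.Surjective π)
    (h : ∀ x y, G.Adj x y → G'.Reachable (π x) (π y)) :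
    Nat.card G'.ConnectedComponent - 1 = 0 := by
  have : G'.Preconnected := by
    intro s t
    obtain ⟨x, rfl⟩ := hπ s
    obtain ⟨y, rfl⟩ := hπ t
    obtain ⟨p⟩ := hG.preconnected x y
    induction p with
    | nil => rfl
    | cons hadj _ ih => exact (h _ _ hadj).trans ih
  have := this.subsingleton_connectedComponent
  have : Nat.card G'.ConnectedComponent ≤ 1 := Finite.card_le_one_iff_subsingleton.2 this
  omega

/-- This is where the connectedness of `B` enters: it makes the derivations for the adjoined identity
and `X` inner. -/
theorem hasDerivationBasis_top_left (hf : ∀ X, supp (f X) = X) (hB : IsConnected B) (X : SupportLattice B)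
    (ι : Type) [Fintype ι] [IsEmpty ι] :
    HasDerivationBasis ι (ind fun m : WithOne B => ⊤ ≤ suppOne m)
      (ind fun m => X ≤ suppOne m) := by
  refine hasDerivationBasis_lset hf (WithTop.coe_lt_top X)
    (fun s t => ∃ b : B, LeR s.1 b ∧ LeR t.1 b) (fun s t _ => ?_) ι ?_
  · simp [WithTop.coe_ne_top]
  · have : Nonempty (LSet f X) := ⟨⟨f X, hf X, f X, (mul_self _).symm⟩⟩
    rw [Nat.card_of_isEmpty]
    refine (card_connectedComponent_sub_one (hB X).1
      (π := fun a => ⟨a.1 * f X, le_antisymm ((le_supp_mul_iff.1 le_rfl).2.trans (hf X).le)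
        (le_supp_mul_iff.2 ⟨a.2.ge, (hf X).ge⟩), a.1, rfl⟩) ?_ ?_).symm
    · rintro ⟨_, h, c, rfl⟩
      exact ⟨⟨_, h⟩, Subtype.ext (by simp only [mul_assoc, mul_self])⟩
    · intro x y hxy
      obtain ⟨-, h⟩ := (SimpleGraph.fromRel_adj _ _ _).1 hxy
      obtain ⟨b, h1, h2⟩ : ∃ b : B, LeR x.1 b ∧ LeR y.1 b := by
        rcases h with ⟨b, h1, h2⟩ | ⟨b, h1, h2⟩
        exacts [⟨b, h1, h2⟩, ⟨b, h2, h1⟩]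
      by_cases he : x.1 * f X = y.1 * f X
      · simp only [he]
        rfl
      · refine SimpleGraph.Adj.reachable ((SimpleGraph.fromRel_adj _ _ _).2
          ⟨fun h => he (congrArg Subtype.val h), Or.inl ⟨b, ?_, ?_⟩⟩)
        · change b * (x.1 * f X) = _
          rw [← mul_assoc, h1]
        · change b * (y.1 * f X) = _
          rw [← mul_assoc, h2]

theorem hasDerivationBasis_top_right (hf : ∀ X, supp (f X) = X) (hB : IsConnected B) (Y : SupportLattice B)
    (ι : Type) [Fintype ι] [IsEmpty ι] :
    HasDerivationBasis ι (ind fun m : WithOne B => Y ≤ suppOne m)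
      (ind fun m => ⊤ ≤ suppOne m) := by
  refine hasDerivationBasis_rset hf (WithTop.coe_lt_top Y)
    (fun s t => ∃ b : B, LeL s.1 b ∧ LeL t.1 b) (fun s t _ => ?_) ι ?_
  · simp [WithTop.coe_ne_top]
  · have : Nonempty (RSet f Y) := ⟨⟨f Y, hf Y, f Y, (mul_self _).symm⟩⟩
    rw [Nat.card_of_isEmpty]
    refine (card_connectedComponent_sub_one (hB Y).2
      (π := fun a => ⟨f Y * a.1, le_antisymm ((le_supp_mul_iff.1 le_rfl).1.trans (hf Y).le)
        (le_supp_mul_iff.2 ⟨(hf Y).ge, a.2.ge⟩), a.1, rfl⟩) ?_ ?_).symm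
    · rintro ⟨_, h, c, rfl⟩
      exact ⟨⟨_, h⟩, Subtype.ext (by simp only [← mul_assoc, mul_self])⟩
    · intro x y hxy
      obtain ⟨-, h⟩ := (SimpleGraph.fromRel_adj _ _ _).1 hxy
      obtain ⟨b, h1, h2⟩ : ∃ b : B, LeL x.1 b ∧ LeL y.1 b := by
        rcases h with ⟨b, h1, h2⟩ | ⟨b, h1, h2⟩
        exacts [⟨b, h1, h2⟩, ⟨b, h2, h1⟩]
      by_cases he : f Y * x.1 = f Y * y.1
      · simp only [he]
        rfl
      · refine SimpleGraph.Adj.reachable ((SimpleGraph.fromRel_adj _ _ _).2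
          ⟨fun h => he (congrArg Subtype.val h), Or.inl ⟨b, ?_, ?_⟩⟩)
        · change f Y * x.1 * b = _
          rw [mul_assoc, h1]
        · change f Y * y.1 * b = _
          rw [mul_assoc, h2]

theorem hasDerivationBasis_numArrows (hf : ∀ X, supp (f X) = X) (X Y : SupportLattice B) :
    HasDerivationBasis (Fin (numArrows f X Y)) (ind fun m : WithOne B => Y ≤ suppOne m)
      (ind fun m => X ≤ suppOne m) := by
  by_cases hXY : X < Y
  · refine hasDerivationBasis_lset hf (WithTop.coe_lt_coe.2 hXY) _ (fun s t _ => ?_) _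
      (?_ : _ = Nat.card (gammaR f Y X).ConnectedComponent - 1)
    · simp only [WithTop.coe_le_coe]
    · rw [Nat.card_fin, numArrows, if_pos hXY]
  by_cases hYX : Y < X
  · refine hasDerivationBasis_rset hf (WithTop.coe_lt_coe.2 hYX) _ (fun s t _ => ?_) _
      (?_ : _ = Nat.card (gammaL f X Y).ConnectedComponent - 1)
    · simp only [WithTop.coe_le_coe]
    · rw [Nat.card_fin, numArrows, if_neg hXY, if_pos hYX]
  have : IsEmpty (Fin (numArrows f X Y)) := by
    rw [numArrows, if_neg hXY, if_neg hYX]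
    infer_instance
  rcases eq_or_ne X Y with rfl | hne
  · exact hasDerivationBasis_self withOne_mul_self _
  · have hle : ¬ X ≤ Y := fun h => hXY (lt_of_le_of_ne h hne)
    have hle' : ¬ Y ≤ X := fun h => hYX (lt_of_le_of_ne h hne.symm)
    refine hasDerivationBasis_of_not_le withOne_mul_self
      (fun a b => isSupportMap.le_mul_iff) (fun a b => isSupportMap.le_mul_iff)
      (f := (f X : WithOne B)) (g := (f Y : WithOne B)) ?_ ?_ ?_ ?_ _ <;>
    simp only [coe_le_suppOne, hf, hle, hle', le_rfl, not_false_eq_true]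

end Basis

end Band

/-! ### The presentation of the algebra of a connected band -/

namespace QuiverRep

/-- A representation whose values lie in a subalgebra `A` is a representation in `A`. -/
theorem exists_lift {V : Type u} [Quiver.{v} V] {A A' : Type*} [NonUnitalRing A] [NonUnitalRing A']
    {θ : A →ₙ+* A'} (hθ : Function.Injective θ) (ρ : QuiverRep V A')
    (h : ∀ p, ∃ a, θ a = ρ.eval p) : ∃ ρ' : QuiverRep V A, ∀ p, θ (ρ'.eval p) = ρ.eval p := by
  choose g hg using h
  have hv : ∀ X, θ (g (QPath.nil X)) = ρ.vert X := fun X => hg _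
  have ha : ∀ {X Y} (a : X ⟶ Y), θ (g ⟨X, Y, a.toPath⟩) = ρ.arr a :=
    fun a => (hg _).trans (ρ.arr_mul_vert a)
  let ρ' : QuiverRep V A :=
    { vert := fun X => g (QPath.nil X)
      arr := fun {X Y} a => g ⟨X, Y, a.toPath⟩
      vert_mul_self := fun X => hθ (by rw [map_mul, hv, ρ.vert_mul_self])
      vert_mul_of_ne := fun h => hθ (by rw [map_mul, hv, hv, ρ.vert_mul_of_ne h, map_zero])
      vert_mul_arr := fun a => hθ (by rw [map_mul, hv, ha, ρ.vert_mul_arr])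
      arr_mul_vert := fun a => hθ (by rw [map_mul, hv, ha, ρ.arr_mul_vert]) }
  refine ⟨ρ', ?_⟩
  rintro ⟨X, Y, p⟩
  change θ (ρ'.evalPath p) = ρ.evalPath p
  induction p with
  | nil => exact hv X
  | cons p a ih =>
    rw [evalPath, evalPath, map_mul, ih]
    exact congrArg (· * _) (ha a)

/-- The ideal of relations of a representation. -/
def kerIdeal {V : Type u} [Quiver.{v} V] [Fintype V] {k : Type w} {S : Type*} [CommRing k]
    [Semigroup S] (ρ : QuiverRep V (MonoidAlgebra k S)) : Ideal (PathAlgebra k V) where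
  carrier := {x | ρ.evalLin x = 0}
  zero_mem' := map_zero _
  add_mem' {x y} hx hy := by
    change ρ.evalLin (x + y) = 0
    rw [map_add, show ρ.evalLin x = 0 from hx, show ρ.evalLin y = 0 from hy, add_zero]
  smul_mem' x y hy := by
    change ρ.evalLin (x * y) = 0
    rw [evalLin_mul, show ρ.evalLin y = 0 from hy, mul_zero]

instance {V : Type u} [Quiver.{v} V] [Fintype V] {k : Type w} {S : Type*} [CommRing k]
    [Semigroup S] (ρ : QuiverRep V (MonoidAlgebra k S)) : ρ.kerIdeal.IsTwoSided where
  mul_mem_of_left {x} y hx := by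
    change ρ.evalLin (x * y) = 0
    rw [evalLin_mul, show ρ.evalLin x = 0 from hx, zero_mul]

end QuiverRep

namespace Band

variable {B : Type u} [Band B]

variable (B) in
/-- The inclusion of the algebra of `B` into the algebra of `B` with an identity adjoined. -/
def coeHom : MonoidAlgebra ℤ B →ₙ+* MonoidAlgebra ℤ (WithOne B) :=
  MonoidAlgebra.mapDomainNonUnitalRingHom ℤ WithOne.coeMulHom

theorem coeHom_injective : Function.Injective (coeHom B) :=
  MonoidAlgebra.mapDomain_injective WithOne.coe_injective

/-- The algebra of `B` is the kernel of the character of the adjoined identity. -/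
theorem exists_coeHom_eq_of_chi_top {x : MonoidAlgebra ℤ (WithOne B)}
    (hx : isSupportMap.chi ⊤ x = 0) : ∃ y, coeHom B y = x := by
  suffices h : ∀ x, ∃ y, coeHom B y + isSupportMap.chi ⊤ x • 1 = x by
    obtain ⟨y, hy⟩ := h x
    rw [hx, zero_smul, add_zero] at hy
    exact ⟨y, hy⟩
  intro x
  induction x using MonoidAlgebra.induction_on with
  | of m =>
    cases m with
    | one =>
      refine ⟨0, ?_⟩
      rw [map_zero, isSupportMap.chi_of_le (isSupportMap.le_one ⊤), one_smul, zero_add]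
      rfl
    | coe b =>
      refine ⟨MonoidAlgebra.single b 1, ?_⟩
      rw [isSupportMap.chi_of_not_le (not_top_le_suppOne b), zero_smul, add_zero]
      exact MonoidAlgebra.mapDomain_single
  | add x x' hx hx' =>
    obtain ⟨y, hy⟩ := hx
    obtain ⟨y', hy'⟩ := hx'
    refine ⟨y + y', ?_⟩
    conv_rhs => rw [← hy, ← hy']
    rw [map_add, map_add, add_smul, add_add_add_comm]
  | smul c x hx =>
    obtain ⟨y, hy⟩ := hx
    refine ⟨c • y, ?_⟩
    conv_rhs => rw [← hy]
    rw [map_zsmul, map_zsmul, smul_add, smul_assoc]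

instance (f : SupportLattice B → B) (X Y : QuiverOf f) : Fintype (X ⟶ Y) :=
  inferInstanceAs (Fintype (Fin (numArrows f X Y)))

/-- The quiver of a connected band has a representation in its integral algebra which is surjective on
the path algebra, with nilpotent arrows and without relations in degrees `0` and `1`. -/
theorem exists_quiverRep_band [Finite B] (hB : IsConnected B) {f : SupportLattice B → B}
    (hf : ∀ X, supp (f X) = X) :
    ∃ ρ : QuiverRep (QuiverOf f) (MonoidAlgebra ℤ B),
      Function.Surjective ρ.evalLin ∧
      (∃ n, 2 ≤ n ∧ ∀ p : QPath (QuiverOf f), n ≤ p.length → ρ.eval p = 0) ∧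
      ∀ x : PathAlgebra ℤ (QuiverOf f), ρ.evalLin x = 0 →
        ∀ p : QPath (QuiverOf f), p.length < 2 → x.coeff p = 0 := by
  have : Fintype (WithTop (SupportLattice B)) :=
    have : Finite (WithTop (SupportLattice B)) :=
      inferInstanceAs (Finite (Option (SupportLattice B)))
    Fintype.ofFinite _
  let j : QuiverOf f → WithTop (SupportLattice B) :=
    fun X => ((show SupportLattice B from X) : WithTop (SupportLattice B))
  have hj : ∀ ω, ω ∉ Set.range j → ω = ⊤ := by
    intro ω hω
    cases ω with
    | top => rfl
    | coe X => exact absurd ⟨X, rfl⟩ hω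
  have htop : ⊤ ∉ Set.range j := by
    rintro ⟨X, hX⟩
    exact WithTop.coe_ne_top hX
  obtain ⟨ρ, h1, h2, ⟨n, hn, h3⟩, h4⟩ := isSupportMap.exists_quiverRep (V := QuiverOf f) (j := j)
    WithTop.coe_injective (fun X Y => hasDerivationBasis_numArrows hf X Y) (by
      rintro ω ω' (h | h)
      · rw [hj ω h]
        cases ω' with
        | top => exact hasDerivationBasis_self withOne_mul_self _
        | coe Y => exact hasDerivationBasis_top_right hf hB Y _
      · rw [hj ω' h]
        cases ω with
        | top => exact hasDerivationBasis_self withOne_mul_self _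
        | coe X => exact hasDerivationBasis_top_left hf hB X _)
  obtain ⟨ρ', hρ'⟩ := ρ.exists_lift coeHom_injective
    (fun p => exists_coeHom_eq_of_chi_top (h1 p ⊤ htop))
  have hlin : ∀ x, coeHom B (ρ'.evalLin x) = ρ.evalLin x := by
    intro x
    induction x using PathAlgebra.induction_on with
    | h0 => simp only [map_zero]
    | h1 c p =>
      rw [map_smul ρ'.evalLin, map_smul ρ.evalLin, QuiverRep.evalLin_ofPath, QuiverRep.evalLin_ofPath, ← hρ']
      exact map_zsmul (coeHom B) c _
    | h2 a b ha hb => simp only [map_add, ha, hb]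
  refine ⟨ρ', fun y => ?_, ⟨n, hn, fun p hp => coeHom_injective ?_⟩, fun x hx => h4 x ?_⟩
  · have hy : coeHom B y ∈ Submodule.span ℤ (Set.range ρ.eval) := by
      refine h2 _ fun ω hω => ?_
      rw [hj ω hω]
      induction y using MonoidAlgebra.induction_linear with
      | zero => simp only [map_zero]
      | add x y hx hy => rw [map_add, map_add, hx, hy, add_zero]
      | single b c =>
        have : coeHom B (MonoidAlgebra.single b c) = c • MonoidAlgebra.of ℤ _ (b : WithOne B) := by
          refine MonoidAlgebra.mapDomain_single.trans ?_
          rw [MonoidAlgebra.of_apply, MonoidAlgebra.smul_single, smul_eq_mul, mul_one]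
          rfl
        rw [this, map_zsmul, isSupportMap.chi_of_not_le (not_top_le_suppOne b), smul_zero]
    have hle : Submodule.span ℤ (Set.range ρ.eval) ≤ LinearMap.range ρ.evalLin := by
      rw [Submodule.span_le]
      rintro _ ⟨p, rfl⟩
      exact ⟨_, ρ.evalLin_ofPath p⟩
    obtain ⟨x, hx⟩ := hle hy
    exact ⟨x, coeHom_injective (by rw [hlin, hx])⟩
  · rw [hρ', h3 p hp, map_zero]
  · rw [← hlin, hx, map_zero]

end Band
end

theorem theoremA {B : Type u} [Band B] [Finite B] (hB : Band.IsConnected B)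
    (f : Band.SupportLattice B → B) (hf : ∀ X, Band.supp (f X) = X) :
    ∃ (I : Ideal (PathAlgebra ℤ (Band.QuiverOf f))) (_ : I.IsTwoSided),
      PathAlgebra.IsAdmissible I ∧
      (∃ φ : MonoidAlgebra ℤ B →ₙₐ[ℤ] (PathAlgebra ℤ (Band.QuiverOf f) ⧸ I),
        Function.Bijective φ) ∧
      ∀ (k : Type w) [CommRing k],
        Function.Injective (PathAlgebra.tensorMap k I) ∧
        PathAlgebra.IsAdmissible (PathAlgebra.tensorIdeal k I) ∧
        ∃ φ : MonoidAlgebra k B →ₙₐ[k]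
            (PathAlgebra k (Band.QuiverOf f) ⧸ PathAlgebra.tensorIdeal k I),
          Function.Bijective φ := by
  obtain ⟨ρ, hsurj, ⟨n, hn, hnil⟩, hker⟩ := Band.exists_quiverRep_band hB hf
  refine ⟨ρ.kerIdeal, inferInstance,
    ρ.isAdmissible hsurj _ (fun _ => Iff.rfl) ⟨n, hn, hnil⟩ hker, ?_, fun k _ => ?_⟩
  · obtain ⟨φ, hφ⟩ := ρ.exists_quotient_equiv hsurj ρ.kerIdeal (fun _ => Iff.rfl)
    exact ⟨{ φ with map_smul' := map_zsmul φ }, hφ⟩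
  · obtain ⟨hinj, hmem⟩ := ρ.tensorMap_injective_and_mem_tensorIdeal_iff k hsurj ρ.kerIdeal
      (fun _ => Iff.rfl)
    have hsurj' := ρ.surjective_evalLin_map k hsurj
    refine ⟨hinj, QuiverRep.isAdmissible _ hsurj' _ hmem
      ⟨n, hn, fun p hp => by rw [QuiverRep.eval_map, hnil p hp, map_zero]⟩ ?_,
      QuiverRep.exists_quotient_equiv _ hsurj' _ hmem⟩
    rintro _ ⟨z, rfl⟩ p hp
    induction z using TensorProduct.induction_on with
    | zero => rw [map_zero]; rfl
    | add y z hy hz =>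
      rw [map_add]
      exact (congrArg₂ (· + ·) hy hz).trans (add_zero 0)
    | tmul c x =>
      rw [PathAlgebra.tensorMap_tmul]
      change c * Int.castRingHom k (x.1.coeff p) = 0
      rw [hker x.1 x.2 p hp, map_zero, mul_zero]
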